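/- **Setting.** Let $G$ be a finite connected 3-regular bipartite plane multigraph (given by its combinatorial embedding: the cyclic order of the edge ends at each vertex, with $|V|-|E|+|F|=2$, and a choice of exterior face), and let $\widetilde G$ be its plane dual. Fix a coloring of the faces of $G$ with the colors white, blue, yellow such that faces sharing an edge have different colors and the exterior face is white. Define: - $G_1$: the directed plane multigraph obtained from $G$ by orienting the boundary of every blue face clockwise (the blue face lies to the right of its boundary arcs) and of every white face counterclockwise (the white face lies to the left); this gives every edge exactly one direction. - $G_2$: the plane multigraph obtained from $G$ by contracting every yellow face to a single vertex; its edges are the edges of $G$ that separate a white face from a blue face. - $G_3$: the subgraph of $\widetilde G$ induced by the non-white vertices. A Hamiltonian cycle is identified with its set of edges (arcs). An *Euler tour* is a closed walk traversing every edge exactly once, up to choice of starting point and reversal. In a plane multigraph it is *kiki* if, whenever it enters a vertex via an edge end, it leaves by an edge end adjacent to it in the cyclic order at that vertex. A *sided* kiki Euler tour also records, at each passage through a vertex, on which side the two edge ends are adjacent (whether the tour leaves by the counterclockwise or by the clockwise neighbor); this is additional information only at vertices of degree at most $2$. A *tree-residue vertex-breaking* of a multigraph with a given set of breakable vertices is a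 set $S$ of breakable vertices such that subdividing every edge and then deleting $S$ leaves a tree. **Lemma.** There are bijections between the following sets: 1. (i) assignments of colors $\{\text{white},\text{blue}\}$ to the yellow vertices of $\widetilde G$ such that afterwards the white vertices induce a connected subgraph of $\widetilde G$ and so do the blue vertices; 2. (ii) Hamiltonian cycles of $G$ which contain (enclose) all blue faces and no white faces; 3. (iii) Hamiltonian cycles of $G$ which use every edge separating a white face from a blue face; 4. (iv) directed Hamiltonian cycles of $G_1$; 5. (v) sided kiki Euler tours of $G_2$; 6. (vi) tree-residue vertex-breakings of $G_3$, where the yellow vertices are breakable and the blue vertices are unbreakable. If no yellow face of $G$ is a digon (so that no vertex of $G_2$ has degree $2$), these sets are also in bijection with 7. (v′) kiki Euler tours of $G_2$ (without sides). The bijections can be chosen as follows. An assignment in (i) corresponds to the cycle in (ii) consisting of the edges that separate white from blue after the assignment. A cycle in (ii) corresponds to the cycle in (iii) with the same edges, and to the vertex-breaking in (vi) whose broken vertices are the yellow faces not enclosed by the cycle. A cycle in (iii) corresponds to the directed cycle in (iv) with the same underlying edges, and to the tour in (v), respectively (v′), such that, for every edge $e$ of $G$ on a yellow face, $e$ lies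 on the cycle if and only if the tour passes directly between the two white–blue edge ends at the ends of $e$ (in (v): turning on the side of $e$). -/

import Mathlib

/-! ### Multigraphs -/

namespace MultiGraph

variable {α β : Type*}

/-- A multigraph is connected if it is nonempty and any two vertices are joined by a walk. -/
def Connected (H : Graph α β) : Prop :=
  H.vertexSet.Nonempty ∧
    ∀ x ∈ H.vertexSet, ∀ y ∈ H.vertexSet, Relation.ReflTransGen H.Adj x y

/-- The degree of a vertex: the number of incident edges, loops counted twice. -/
noncomputable def degree (H : Graph α β) (x : α) : ℕ∞ :=
  (H.incidenceSet x).encard + (H.loopSet x).encard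

def Bipartite (H : Graph α β) : Prop :=
  ∃ s : α → Bool, ∀ x y, H.Adj x y → s x ≠ s y

/-- A Hamiltonian cycle, given by its edge set: a connected 2-regular spanning subgraph. -/
def IsHamiltonianCycle (H : Graph α β) (C : Set β) : Prop :=
  C ⊆ H.edgeSet ∧ Connected (H.restrict C) ∧ ∀ x ∈ H.vertexSet, degree (H.restrict C) x = 2

/-- The graph obtained from `H` by subdividing every edge once and then deleting the vertices
in `S`: its vertices are the vertices of `H` outside `S` and the edges of `H` (their midpoints).
A loop of `H` would become a pair of parallel edges, of which this simple graph keeps one. -/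
def subdivideDelete (H : Graph α β) (S : Set α) :
    SimpleGraph ({x : α // x ∈ H.vertexSet ∧ x ∉ S} ⊕ {e : β // e ∈ H.edgeSet}) :=
  SimpleGraph.fromRel fun p q =>
    ∃ (x : {x : α // x ∈ H.vertexSet ∧ x ∉ S}) (e : {e : β // e ∈ H.edgeSet}),
      p = Sum.inl x ∧ q = Sum.inr e ∧ H.Inc e.1 x.1

/-- `S` solves Tree-Residue Vertex-Breaking on `H` with breakable vertices `B`: breaking the
vertices in `S` leaves a tree. (A loop at an unbroken vertex is a cycle.) -/
def IsTRVB (H : Graph α β) (B S : Set α) : Prop :=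
  S ⊆ H.vertexSet ∩ B ∧ (∀ e x, H.IsLoopAt e x → x ∈ S) ∧ (subdivideDelete H S).IsTree

end MultiGraph

/-! ### Embedded multigraphs -/

/-- A multigraph without isolated vertices, embedded in an oriented surface, given by its rotation
system. The elements of `D` are the darts (edge ends): a dart `d` is an edge together with one of
its two directions, and it is attached to the vertex it leaves. -/
structure RotationSystem (D : Type*) where
  /-- The next dart counterclockwise around the same vertex. -/
  next : Equiv.Perm D
  /-- The same edge in the opposite direction. -/
  flip : Equiv.Perm D
  flip_flip : ∀ d, flip (flip d) = d
  flip_ne : ∀ d, flip d ≠ d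

namespace RotationSystem

variable {D : Type*} (R : RotationSystem D)

/-- The vertices are the cycles of `next`. -/
def Vertex : Type _ := Quotient (Equiv.Perm.SameCycle.setoid R.next)

/-- The vertex that a dart leaves. -/
def src (d : D) : R.Vertex := Quotient.mk _ d

/-- The vertex that a dart enters. -/
def tgt (d : D) : R.Vertex := R.src (R.flip d)

/-- The next dart on the boundary walk of the face to the left of a dart. -/
def faceNext : Equiv.Perm D := R.next⁻¹ * R.flip

/-- The faces are the cycles of `faceNext`. -/
def Face : Type _ := Quotient (Equiv.Perm.SameCycle.setoid R.faceNext)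

/-- The face to the left of a dart. -/
def left (d : D) : R.Face := Quotient.mk _ d

/-- The face to the right of a dart. -/
def right (d : D) : R.Face := R.left (R.flip d)

/-- Two darts lie on the same edge if they are equal or opposite. -/
def edgeSetoid : Setoid D where
  r x y := x = y ∨ x = R.flip y
  iseqv :=
    { refl := fun _ => Or.inl rfl
      symm := by
        rintro x y (rfl | rfl)
        · exact Or.inl rfl
        · exact Or.inr (R.flip_flip y).symm
      trans := by
        rintro x y z (rfl | rfl) (rfl | rfl)
        · exact Or.inl rfl
        · exact Or.inr rfl
        · exact Or.inr rfl
        · exact Or.inl (R.flip_flip z) }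

def Edge : Type _ := Quotient R.edgeSetoid

def edge (d : D) : R.Edge := Quotient.mk R.edgeSetoid d

theorem edge_eq_iff (x y : D) : R.edge x = R.edge y ↔ x = y ∨ x = R.flip y :=
  Quotient.eq (r := R.edgeSetoid)

/-- The multigraph in which the edge of `d` joins `f d` and `f (flip d)`. -/
def linkGraph {W : Type*} (f : D → W) : Graph W R.Edge where
  vertexSet := Set.univ
  IsLink e x y := ∃ d, R.edge d = e ∧ f d = x ∧ f (R.flip d) = y
  isLink_symm := by
    intro e _
    refine ⟨?_⟩
    rintro x y ⟨d, rfl, rfl, rfl⟩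
    exact ⟨R.flip d, (R.edge_eq_iff _ _).2 (Or.inr rfl), rfl, by rw [R.flip_flip]⟩
  eq_or_eq_of_isLink_of_isLink := by
    rintro e x y v w ⟨d, rfl, rfl, rfl⟩ ⟨d', h, rfl, rfl⟩
    rcases (R.edge_eq_iff _ _).1 h with rfl | rfl
    · exact Or.inl rfl
    · exact Or.inr (by rw [R.flip_flip])
  left_mem_of_isLink := fun _ _ _ _ => Set.mem_univ _

/-- The underlying multigraph. -/
def graph : Graph R.Vertex R.Edge := R.linkGraph R.src

/-- The dual multigraph: its vertices are the faces, and each edge joins the faces on its two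
sides. -/
def dual : Graph R.Face R.Edge := R.linkGraph R.left

/-- A rotation system describes a connected multigraph on the sphere: it is connected and has
genus zero. A plane multigraph is such a rotation system with a choice of an exterior face. -/
def IsConnectedPlane : Prop :=
  MultiGraph.Connected R.graph ∧
    Nat.card R.Vertex + Nat.card R.Face = Nat.card R.Edge + 2

/-- Every vertex has exactly three darts. -/
def IsCubic : Prop := ∀ d, R.next d ≠ d ∧ R.next (R.next (R.next d)) = d

/-- The face `f` is inside `C`, where `C` is the edge set of a cycle: one cannot get from the
exterior face to `f` without crossing an edge of `C`. -/
def IsInside (outer : R.Face) (C : Set R.Edge) (f : R.Face) : Prop :=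
  ¬ Relation.ReflTransGen (R.dual.deleteEdges C).Adj outer f

/-- A directed Hamiltonian cycle, given by its set of arcs, of the orientation of the multigraph
whose arcs are the darts in `O`. -/
def IsDirectedHamiltonianCycle (O A : Set D) : Prop :=
  A ⊆ O ∧ (∀ v, ∃! d, d ∈ A ∧ R.src d = v) ∧ (∀ v, ∃! d, d ∈ A ∧ R.tgt d = v) ∧
    ∀ u v, Relation.ReflTransGen (fun x y => ∃ d ∈ A, R.src d = x ∧ R.tgt d = y) u v

/-! ### Kiki Euler tours -/

/-- An Euler tour, as a cyclic sequence of darts: a closed walk which traverses every edge exactly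
once, in one of its two directions. -/
def IsEulerTour (t : Cycle D) : Prop :=
  t.Nodup ∧ (∀ d, d ∈ t ↔ R.flip d ∉ t) ∧ t.Chain fun d d' => R.src d' = R.tgt d

/-- An Euler tour is kiki if after each dart `d` (which enters a vertex through the end `flip d`)
it continues with one of the two neighbors of `flip d` in the cyclic order. -/
def IsKikiEulerTour (t : Cycle D) : Prop :=
  R.IsEulerTour t ∧
    t.Chain fun d d' => d' = R.next (R.flip d) ∨ d' = R.next⁻¹ (R.flip d)

/-- Kiki Euler tours, where a tour and its reverse are the same. -/
def KikiEulerTour : Type _ :=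
  Quot fun t t' : {t : Cycle D // R.IsKikiEulerTour t} => t'.1 = t.1.reverse.map R.flip

/-- In the cyclic sequence `t`, an occurrence of `x` is immediately followed by `y`. -/
def FollowedBy (t : Cycle D) (x y : D) : Prop :=
  ∃ l : List D, t = ((x :: l : List D) : Cycle D) ∧ (l ++ [x]).head? = some y

/-- A turn `(x, b)` enters a vertex through the end `x` and leaves through the next end
counterclockwise if `b` is true and clockwise if `b` is false. This is the dart on which it
leaves. -/
def exit (p : D × Bool) : D := if p.2 = true then R.next p.1 else R.next⁻¹ p.1

/-- A kiki Euler tour together with the side on which it turns at each vertex passage, as a cyclic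
sequence of turns. The sides are extra information only at vertices of degree at most 2. -/
def IsSidedKikiEulerTour (t : Cycle (D × Bool)) : Prop :=
  R.IsEulerTour (t.map R.exit) ∧ t.Chain fun p q => q.1 = R.flip (R.exit p)

/-- Kiki Euler tours with sides, where a tour and its reverse are the same. -/
def SidedKikiEulerTour : Type _ :=
  Quot fun t t' : {t : Cycle (D × Bool) // R.IsSidedKikiEulerTour t} =>
    t'.1 = t.1.reverse.map fun p => (R.exit p, !p.2)

end RotationSystem

/-! ### Face 3-colorings -/

inductive FaceColor where
  | white : FaceColor
  | blue : FaceColor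
  | yellow : FaceColor

namespace RotationSystem

variable {D : Type*} (R : RotationSystem D)

/-- Faces sharing an edge have different colors. -/
def IsProperFaceColoring (c : R.Face → FaceColor) : Prop :=
  ∀ d, c (R.left d) ≠ c (R.right d)

/-- The edge of `d` separates a white face from a blue face. -/
def IsWhiteBlue (c : R.Face → FaceColor) (d : D) : Prop :=
  (c (R.left d) = FaceColor.white ∧ c (R.right d) = FaceColor.blue) ∨
    (c (R.left d) = FaceColor.blue ∧ c (R.right d) = FaceColor.white)

/-- `a` recolors every yellow face white or blue and keeps all other colors, in such a way that
the white faces and the blue faces both induce connected subgraphs of the dual. -/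
def IsConnectedRecoloring (c a : R.Face → FaceColor) : Prop :=
  (∀ f, c f ≠ FaceColor.yellow → a f = c f) ∧ (∀ f, a f ≠ FaceColor.yellow) ∧
    MultiGraph.Connected (R.dual.induce {f | a f = FaceColor.white}) ∧
    MultiGraph.Connected (R.dual.induce {f | a f = FaceColor.blue})

/-- The Hamiltonian cycles that contain all blue faces and no white faces. -/
def IsSeparatingHamiltonianCycle (outer : R.Face) (c : R.Face → FaceColor)
    (C : Set R.Edge) : Prop :=
  MultiGraph.IsHamiltonianCycle R.graph C ∧
    (∀ f, c f = FaceColor.blue → R.IsInside outer C f) ∧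
    (∀ f, c f = FaceColor.white → ¬ R.IsInside outer C f)

/-- The Hamiltonian cycles that use every edge separating a white face from a blue face. -/
def IsWhiteBlueHamiltonianCycle (c : R.Face → FaceColor) (C : Set R.Edge) : Prop :=
  MultiGraph.IsHamiltonianCycle R.graph C ∧ ∀ d, R.IsWhiteBlue c d → R.edge d ∈ C

/-- The arcs of the orientation in which every blue face is clockwise (on the right of the arcs of
its boundary) and every white face is counterclockwise (on the left). -/
def orientation (c : R.Face → FaceColor) : Set D :=
  {d | c (R.left d) = FaceColor.white ∨ c (R.right d) = FaceColor.blue}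

theorem right_flip (d : D) : R.right (R.flip d) = R.left d := by
  rw [right, R.flip_flip]

/-- Every edge receives exactly one direction. -/
theorem mem_orientation_iff {c : R.Face → FaceColor} (hc : R.IsProperFaceColoring c) (d : D) :
    d ∈ R.orientation c ↔ R.flip d ∉ R.orientation c := by
  have h := hc d
  have h1 : R.left (R.flip d) = R.right d := rfl
  simp only [orientation, Set.mem_ofPred_eq, right_flip, h1]
  cases h2 : c (R.left d) <;> cases h3 : c (R.right d) <;> simp_all

theorem left_faceNext (d : D) : R.left (R.faceNext d) = R.left d :=
  Quotient.sound (s := Equiv.Perm.SameCycle.setoid R.faceNext) ⟨-1, by simp⟩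

theorem left_next_symm (d : D) : R.left (R.next⁻¹ d) = R.right d := by
  have h := R.left_faceNext (R.flip d)
  rwa [faceNext, Equiv.Perm.mul_apply, R.flip_flip] at h

theorem isWhiteBlue_iff {c : R.Face → FaceColor} (h3 : R.IsCubic)
    (hc : R.IsProperFaceColoring c) (d : D) :
    R.IsWhiteBlue c d ↔ c (R.left (R.next d)) = FaceColor.yellow := by
  have e1 : R.next⁻¹ (R.next d) = d := by simp
  have e2 : R.next⁻¹ d = R.next (R.next d) := by
    rw [Equiv.Perm.inv_eq_iff_eq]; exact (h3 d).2.symm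
  have e3 : R.next⁻¹ (R.next (R.next d)) = R.next d := by simp
  have a1 := hc (R.next d)
  rw [← R.left_next_symm, e1] at a1
  have a2 := hc (R.next (R.next d))
  rw [← R.left_next_symm, e3] at a2
  have a3 := hc d
  rw [← R.left_next_symm, e2] at a3
  rw [IsWhiteBlue, ← R.left_next_symm, e2]
  cases h4 : c (R.left d) <;> cases h5 : c (R.left (R.next d)) <;>
    cases h6 : c (R.left (R.next (R.next d))) <;> simp_all

theorem isWhiteBlue_flip (c : R.Face → FaceColor) (d : D) :
    R.IsWhiteBlue c (R.flip d) ↔ R.IsWhiteBlue c d := by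
  have h1 : R.left (R.flip d) = R.right d := rfl
  rw [IsWhiteBlue, IsWhiteBlue, right_flip, h1]
  tauto

/-- The plane multigraph obtained by contracting every yellow face to a vertex.
The edges bordering yellow faces disappear; the white-blue edges stay. Each vertex of a cubic
map with a proper face 3-coloring lies on one yellow face and one white-blue edge, and if `d` is
its white-blue dart then `next d` has the yellow face on its left. Hence the white-blue darts
attached to a yellow face, in counterclockwise order around it, are found by walking along its
boundary: from `d` turn to `next d`, go to the next dart of the boundary walk, and turn back to
the white-blue dart there. -/
def contractYellow (c : R.Face → FaceColor) (h3 : R.IsCubic) (hc : R.IsProperFaceColoring c) :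
    RotationSystem {d : D // R.IsWhiteBlue c d} where
  next := (R.next⁻¹ * R.faceNext * R.next).subtypePerm (by
    intro d
    rw [R.isWhiteBlue_iff h3 hc, R.isWhiteBlue_iff h3 hc]
    have e : R.next (R.next⁻¹ (R.faceNext (R.next d))) = R.faceNext (R.next d) := by simp
    rw [Equiv.Perm.mul_apply, Equiv.Perm.mul_apply, e, left_faceNext])
  flip := R.flip.subtypePerm (R.isWhiteBlue_flip c)
  flip_flip := fun d => Subtype.ext (R.flip_flip d.1)
  flip_ne := fun d h => R.flip_ne d.1 (congrArg Subtype.val h)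

/-- The vertices of the contraction are the yellow faces: two white-blue darts are attached to the
same vertex exactly if the vertices of `R` that they leave lie on the same yellow face. -/
theorem contractYellow_src_eq_iff (c : R.Face → FaceColor) (h3 : R.IsCubic)
    (hc : R.IsProperFaceColoring c) (d d' : {d : D // R.IsWhiteBlue c d}) :
    (R.contractYellow c h3 hc).src d = (R.contractYellow c h3 hc).src d' ↔
      R.left (R.next d.1) = R.left (R.next d'.1) := by
  have key : (R.contractYellow c h3 hc).next.SameCycle d d' ↔
      R.faceNext.SameCycle (R.next d.1) (R.next d'.1) := by
    rw [contractYellow, Equiv.Perm.sameCycle_subtypePerm]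
    have h := Equiv.Perm.sameCycle_conj (f := R.faceNext) (g := R.next⁻¹) (x := d.1) (y := d'.1)
    simpa using h
  exact (Quotient.eq (r := Equiv.Perm.SameCycle.setoid _)).trans
    (key.trans (Quotient.eq (r := Equiv.Perm.SameCycle.setoid R.faceNext)).symm)

/-- The subgraph of the dual induced by the non-white faces. -/
def nonwhiteDual (c : R.Face → FaceColor) : Graph R.Face R.Edge :=
  R.dual.induce {f | c f ≠ FaceColor.white}

/-- No yellow face is a digon. -/
def NoYellowDigon (c : R.Face → FaceColor) : Prop :=
  ∀ d, c (R.left d) = FaceColor.yellow → R.faceNext (R.faceNext d) ≠ d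

end RotationSystem

/-! ### Connectedness in terms of invariant predicates -/

namespace MultiGraph

variable {α β : Type*}

/-! All the sets are compared through one description of a cycle in (iii): an edge set `C` that
contains every white-blue edge and exactly one of the two other edges at each vertex
(`IsAlternating`), and that is connected (`ConnectedBy`). Connectedness is always used in the form
"every invariant predicate is constant", which transfers easily between vertices, faces and darts.

The topological input is linear algebra over the field with two elements. Vertex cuts and face cuts
are orthogonal, and Euler's formula makes their dimensions complementary; hence every even edge set
bounds a set of faces (`IsConnectedPlane.exists_boundary`). This replaces the Jordan curve theorem.
For an edge set with two edges at each vertex, being connected is then equivalent to each of its two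
sides being connected (`connectedBy_of_forall_invariant`, `forall_invariant_of_connectedBy`). A
recoloring has an alternating boundary because the yellow face at a vertex joins either the white or
the blue face there. Conversely, the sides of an alternating cycle respect the given colors by
`IsAlternating.white_iff_white`. This links (i), (ii) and (iii).

For (iv), at each vertex the white-blue edge points out exactly when the two others point in, so one
arc in and one arc out is the alternation condition. For (vi), cycle-cut duality turns connectedness
of the boundary into the bridge property of edges inside the blue region, and
`IsRecoloring.connectedBy_of_isTree` turns it back.

For (v), edges of `G` on yellow faces are the corners of the contraction. A choice of alternate
corners pairs the edge ends at each vertex and so splits the edges into closed curves; the cycle is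
connected exactly if there is a single curve (`isWhiteBlueHamiltonianCycle_iff_isTourCorners`). The
two-coloring of darts by whether white lies on the left prevents a curve from using an edge in both
directions (`IsTourCorners.exists_sidedCorners_eq`). Without digons the sides are determined by the
tour, which gives (v′). -/

theorem connected_iff_forall_invariant (H : Graph α β) :
    Connected H ↔ H.vertexSet.Nonempty ∧ ∀ P : α → Prop, (∀ x y, H.Adj x y → P x → P y) →
      ∀ x ∈ H.vertexSet, ∀ y ∈ H.vertexSet, P x → P y := by
  refine and_congr_right fun _ => ⟨fun h P hP x hx y hy hPx => ?_, fun h x hx y hy =>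
    h (Relation.ReflTransGen H.Adj x) (fun _ _ hab hxa => hxa.tail hab) x hx y hy .refl⟩
  induction h x hx y hy with
  | refl => exact hPx
  | tail h₁ h₂ ih => exact hP _ _ h₂ (ih h₂.left_mem)

end MultiGraph

/-! ### Cycle space and cut space of a plane multigraph -/

theorem ZMod.add_eq_one_iff_ne (a b : ZMod 2) : a + b = 1 ↔ a ≠ b := by
  revert a b; decide

theorem ZMod.add_eq_zero_iff_eq_two (a b : ZMod 2) : a + b = 0 ↔ a = b := by
  revert a b; decide

namespace RotationSystem

variable {D : Type*} (R : RotationSystem D)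

instance [Finite D] : Finite R.Vertex := Quotient.finite _
instance [Finite D] : Finite R.Face := Quotient.finite _
instance [Finite D] : Finite R.Edge := Quotient.finite _
noncomputable instance [Finite D] : Fintype R.Vertex := Fintype.ofFinite _
noncomputable instance [Finite D] : Fintype R.Face := Fintype.ofFinite _
noncomputable instance [Finite D] : Fintype R.Edge := Fintype.ofFinite _

theorem exists_src_eq (v : R.Vertex) : ∃ d, R.src d = v := Quotient.exists_rep v
theorem exists_left_eq (f : R.Face) : ∃ d, R.left d = f := Quotient.exists_rep f
theorem exists_edge_eq (e : R.Edge) : ∃ d, R.edge d = e := Quotient.exists_rep e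

theorem src_next (d : D) : R.src (R.next d) = R.src d :=
  Quotient.sound (s := Equiv.Perm.SameCycle.setoid R.next) ⟨-1, by simp⟩

theorem src_next_symm (d : D) : R.src (R.next⁻¹ d) = R.src d :=
  Quotient.sound (s := Equiv.Perm.SameCycle.setoid R.next) ⟨1, by simp⟩

theorem src_flip (d : D) : R.src (R.flip d) = R.tgt d := rfl

theorem tgt_flip (d : D) : R.tgt (R.flip d) = R.src d := by rw [tgt, R.flip_flip]

theorem left_flip (d : D) : R.left (R.flip d) = R.right d := rfl

theorem edge_flip (d : D) : R.edge (R.flip d) = R.edge d := (R.edge_eq_iff _ _).2 (Or.inr rfl)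

theorem right_next (d : D) : R.right (R.next d) = R.left d := by
  rw [← R.left_next_symm]; simp

theorem src_faceNext (d : D) : R.src (R.faceNext d) = R.tgt d := by
  rw [faceNext, Equiv.Perm.mul_apply, src_next_symm, src_flip]

/-- Vertices and faces are orbits, so constancy on one of them can be checked at a single step of
the permutation. `Q` confines the check to one orbit, as is needed for a single face. -/
theorem invariant_of_sameCycle {f : Equiv.Perm D} {P : D → Prop} {Q : D → Prop}
    (hQ : ∀ d, Q (f d) ↔ Q d) (hP : ∀ d, Q d → (P (f d) ↔ P d)) {x y : D} (h : f.SameCycle x y)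
    (hx : Q x) : P x ↔ P y := by
  obtain ⟨i, rfl⟩ := h
  suffices Q ((f ^ i) x) ∧ (P x ↔ P ((f ^ i) x)) from this.2
  induction i using Int.induction_on with
  | zero => exact ⟨hx, Iff.rfl⟩
  | succ i ih =>
    rw [add_comm, zpow_add, zpow_one, Equiv.Perm.mul_apply]
    exact ⟨(hQ _).2 ih.1, ih.2.trans (hP _ ih.1).symm⟩
  | pred i ih =>
    have e : f ((f ^ (-(i : ℤ) - 1)) x) = (f ^ (-(i : ℤ))) x := by
      rw [← Equiv.Perm.mul_apply, ← zpow_one_add]; congr 2; ring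
    rw [← e] at ih
    have h1 := (hQ _).1 ih.1
    exact ⟨h1, ih.2.trans (hP _ h1)⟩

theorem iff_of_src_eq {P : D → Prop} (hP : ∀ d, P (R.next d) ↔ P d) {x y : D}
    (h : R.src x = R.src y) : P x ↔ P y :=
  invariant_of_sameCycle (Q := fun _ => True) (fun _ => Iff.rfl) (fun d _ => hP d)
    (Quotient.exact (s := Equiv.Perm.SameCycle.setoid R.next) h) trivial

theorem iff_of_left_eq {P : D → Prop} {f : R.Face}
    (hP : ∀ d, R.left d = f → (P (R.faceNext d) ↔ P d)) {x y : D}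
    (hx : R.left x = f) (hy : R.left y = f) : P x ↔ P y :=
  invariant_of_sameCycle (Q := fun d => R.left d = f) (fun d => by rw [left_faceNext])
    hP (Quotient.exact (s := Equiv.Perm.SameCycle.setoid R.faceNext) (hx.trans hy.symm)) hx

/-- The coboundary mod 2 of a function on the vertices of a link graph. -/
def coboundary {W : Type*} (f : D → W) : (W → ZMod 2) →ₗ[ZMod 2] (R.Edge → ZMod 2) where
  toFun x e := Quotient.liftOn e (fun d => x (f d) + x (f (R.flip d))) (by
    rintro a b (rfl | rfl)
    · rfl
    · simp only [R.flip_flip]; exact add_comm _ _)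
  map_add' x y := by
    ext e
    obtain ⟨d, rfl⟩ := R.exists_edge_eq e
    exact add_add_add_comm _ _ _ _
  map_smul' a x := by
    ext e
    obtain ⟨d, rfl⟩ := R.exists_edge_eq e
    exact (mul_add _ _ _).symm

theorem coboundary_edge {W : Type*} (f : D → W) (x : W → ZMod 2) (d : D) :
    R.coboundary f x (R.edge d) = x (f d) + x (f (R.flip d)) := rfl

/-- Rank-nullity: by connectedness the kernel consists of the constant functions and has dimension
one. -/
theorem finrank_range_coboundary {W : Type*} [Fintype W] [Nonempty W] [Finite D] (f : D → W)
    (h : ∀ x : W → ZMod 2, (∀ d, x (f d) = x (f (R.flip d))) → ∀ u v, x u = x v) :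
    Module.finrank (ZMod 2) (LinearMap.range (R.coboundary f)) + 1 = Nat.card W := by
  have hk : LinearMap.ker (R.coboundary f) = Submodule.span (ZMod 2) {fun _ => 1} := by
    ext x
    rw [LinearMap.mem_ker, Submodule.mem_span_singleton]
    constructor
    · intro hx
      obtain ⟨w⟩ := ‹Nonempty W›
      refine ⟨x w, funext fun v => ?_⟩
      simp only [Pi.smul_apply, smul_eq_mul, mul_one]
      exact h x (fun d => (ZMod.add_eq_zero_iff_eq_two _ _).1 (congrFun hx (R.edge d))) _ _
    · rintro ⟨a, rfl⟩
      ext e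
      obtain ⟨d, rfl⟩ := R.exists_edge_eq e
      rw [coboundary_edge]
      exact (ZMod.add_eq_zero_iff_eq_two _ _).2 rfl
  have h1 := LinearMap.finrank_range_add_finrank_ker (R.coboundary f)
  have hne : (fun _ : W => (1 : ZMod 2)) ≠ 0 := by
    obtain ⟨w⟩ := ‹Nonempty W›
    exact fun h => one_ne_zero (congrFun h w)
  rw [hk, finrank_span_singleton hne, Module.finrank_fintype_fun_eq_card] at h1
  rw [h1, Nat.card_eq_fintype_card]

theorem sum_edge_eq_sum_dart {M : Type*} [AddCommMonoid M] [Fintype D] (g : D → M)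
    (h : R.Edge → M) (H : ∀ d, h (R.edge d) = g d + g (R.flip d)) :
    ∑ e, h e = ∑ d, g d := by
  classical
  rw [← Finset.sum_fiberwise Finset.univ R.edge g]
  refine Finset.sum_congr rfl fun e _ => ?_
  obtain ⟨d, rfl⟩ := R.exists_edge_eq e
  have : (Finset.univ.filter fun x => R.edge x = R.edge d) = {d, R.flip d} := by
    ext x
    simp [R.edge_eq_iff]
  rw [H, this, Finset.sum_pair (R.flip_ne d).symm]

theorem sum_coboundary_mul [Fintype D] (k : R.Vertex → ZMod 2) (y : R.Edge → ZMod 2) :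
    ∑ e, R.coboundary R.src k e * y e = ∑ d, k (R.src d) * y (R.edge d) :=
  R.sum_edge_eq_sum_dart _ _ fun d => by rw [coboundary_edge, add_mul, R.edge_flip]

/-- Cuts of a multigraph and cuts of its dual are orthogonal. -/
theorem sum_coboundary_mul_coboundary [Finite D] (k : R.Vertex → ZMod 2) (x : R.Face → ZMod 2) :
    ∑ e, R.coboundary R.src k e * R.coboundary R.left x e = 0 := by
  cases nonempty_fintype D
  rw [sum_coboundary_mul]
  have h1 : ∀ d, k (R.src d) * R.coboundary R.left x (R.edge d) =
      k (R.src d) * x (R.left d) + k (R.src d) * x (R.right d) := fun d => by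
    rw [coboundary_edge, mul_add, left_flip]
  simp only [h1]
  -- The right face of `next d` is the left face of `d`. Reindexing by `next` therefore makes the
  -- two dart sums equal, and they cancel mod 2.
  rw [Finset.sum_add_distrib,
    ← Equiv.sum_comp R.next (fun d => k (R.src d) * x (R.right d)), ZMod.add_eq_zero_iff_eq_two]
  simp only [R.src_next, R.right_next]

theorem IsConnectedPlane.nonempty {R : RotationSystem D} (h : R.IsConnectedPlane) : Nonempty D :=
  let ⟨v, _⟩ := h.1.1
  let ⟨d, _⟩ := R.exists_src_eq v
  ⟨d⟩

theorem IsConnectedPlane.vertex_invariant {R : RotationSystem D} (h : R.IsConnectedPlane)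
    {P : R.Vertex → Prop} (hP : ∀ d, P (R.src d) → P (R.tgt d)) (u v : R.Vertex) (hu : P u) :
    P v := by
  refine ((MultiGraph.connected_iff_forall_invariant _).1 h.1).2 P ?_ u trivial v trivial hu
  rintro x y ⟨e, d, rfl, rfl, rfl⟩
  exact hP d

/-- The dual inherits connectedness: the faces around a vertex are linked across the edges there,
and the two ends of an edge share the faces on its sides. -/
theorem IsConnectedPlane.face_invariant {R : RotationSystem D} (h : R.IsConnectedPlane)
    {P : R.Face → Prop} (hP : ∀ d, P (R.left d) → P (R.right d)) (u v : R.Face) (hu : P u) :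
    P v := by
  have hP' : ∀ d, P (R.left d) ↔ P (R.right d) := fun d =>
    ⟨hP d, fun h => by simpa only [right_flip] using hP (R.flip d) h⟩
  have hs : ∀ x y, R.src x = R.src y → (P (R.left x) ↔ P (R.left y)) := fun x y =>
    R.iff_of_src_eq (P := fun d => P (R.left d)) fun d => by rw [hP' (R.next d), right_next]
  obtain ⟨x, rfl⟩ := R.exists_left_eq u
  obtain ⟨y, rfl⟩ := R.exists_left_eq v
  have := h.vertex_invariant (P := fun v => ∀ d, R.src d = v → P (R.left d)) ?_ (R.src x) (R.src y)
    fun d hd => (hs d x hd).2 hu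
  · exact this y rfl
  · intro d hd d' hd'
    rw [hs d' (R.flip d) hd', left_flip]
    exact hP d (hd d rfl)

/-- In a plane multigraph, every cycle mod 2 is the boundary of a set of faces. -/
theorem IsConnectedPlane.exists_boundary [Finite D] {R : RotationSystem D}
    (h : R.IsConnectedPlane) (y : R.Edge → ZMod 2)
    (hy : ∀ k, ∑ e, R.coboundary R.src k e * y e = 0) :
    ∃ x : R.Face → ZMod 2, ∀ d, y (R.edge d) = x (R.left d) + x (R.right d) := by
  classical
  obtain ⟨d₀⟩ := h.nonempty
  have : Nonempty R.Vertex := ⟨R.src d₀⟩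
  have : Nonempty R.Face := ⟨R.left d₀⟩
  have hv := R.finrank_range_coboundary R.src fun x hx u v =>
    (h.vertex_invariant (P := fun w => x u = x w) (fun d hd => hd.trans (hx d)) u v rfl)
  have hf := R.finrank_range_coboundary R.left fun x hx u v =>
    (h.face_invariant (P := fun w => x u = x w) (fun d hd => hd.trans (hx d)) u v rfl)
  -- `T` pairs an edge vector with all vertex cuts, so its kernel is the cycle space.
  let T := (R.coboundary R.src).dualMap.comp (dotProductEquiv (ZMod 2) R.Edge).toLinearMap
  have hT : ∀ y k, T y k = ∑ e, R.coboundary R.src k e * y e := fun y k => by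
    simp only [T, LinearMap.comp_apply, LinearMap.dualMap_apply, LinearEquiv.coe_coe,
      dotProductEquiv_apply_apply, dotProduct]
    exact Finset.sum_congr rfl fun e _ => mul_comm _ _
  have hle : LinearMap.range (R.coboundary R.left) ≤ LinearMap.ker T := by
    rintro _ ⟨x, rfl⟩
    exact LinearMap.ext fun k => (hT _ k).trans (R.sum_coboundary_mul_coboundary k x)
  have hr : Module.finrank (ZMod 2) (LinearMap.range T) =
      Module.finrank (ZMod 2) (LinearMap.range (R.coboundary R.src)) := by
    rw [← LinearMap.finrank_range_dualMap_eq_finrank_range (R.coboundary R.src),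
      LinearMap.range_comp, LinearEquiv.range, Submodule.map_top]
  have hrk := LinearMap.finrank_range_add_finrank_ker T
  rw [Module.finrank_fintype_fun_eq_card, ← Nat.card_eq_fintype_card, hr] at hrk
  -- Face cuts have dimension `|F| - 1` and the cycle space has dimension `|E| - (|V| - 1)`; Euler's
  -- formula says that these agree.
  have heq := Submodule.eq_of_le_of_finrank_eq hle (by have := h.2; omega)
  have hmem : y ∈ LinearMap.ker T := LinearMap.ext fun k => (hT y k).trans (hy k)
  rw [← heq] at hmem
  obtain ⟨x, rfl⟩ := hmem
  exact ⟨x, fun d => rfl⟩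

end RotationSystem

/-! ### Hamiltonian cycles of cubic maps with a proper face coloring -/

namespace RotationSystem

variable {D : Type*} {R : RotationSystem D}

theorem IsCubic.next_symm (h3 : R.IsCubic) (d : D) : R.next⁻¹ d = R.next (R.next d) := by
  rw [Equiv.Perm.inv_eq_iff_eq]; exact (h3 d).2.symm

theorem IsCubic.next_symm_next_symm (h3 : R.IsCubic) (d : D) : R.next⁻¹ (R.next⁻¹ d) = R.next d := by
  rw [h3.next_symm (R.next⁻¹ d)]; simp

theorem IsCubic.next_symm_ne (h3 : R.IsCubic) (d : D) : R.next⁻¹ d ≠ d := fun h =>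
  (h3 d).1 (by conv_lhs => rw [← h]
               simp)

theorem IsCubic.next_ne_next_symm (h3 : R.IsCubic) (d : D) : R.next d ≠ R.next⁻¹ d := by
  rw [h3.next_symm]; exact (h3 (R.next d)).1.symm

theorem IsCubic.src_eq_iff (h3 : R.IsCubic) (x d : D) :
    R.src x = R.src d ↔ x = d ∨ x = R.next d ∨ x = R.next⁻¹ d := by
  constructor
  · intro h
    refine (R.iff_of_src_eq (P := fun x => x = d ∨ x = R.next d ∨ x = R.next⁻¹ d) ?_ h).2
      (Or.inl rfl)
    intro y
    have e := h3.next_symm d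
    have e2 := (h3 d).2
    constructor
    · rintro (h | h | h)
      · right; right; rw [← h]; simp
      · left; exact R.next.injective h
      · right; left; apply R.next.injective; rw [h, e]
    · rintro (rfl | rfl | rfl)
      · right; left; rfl
      · right; right; exact e.symm
      · left; simp
  · rintro (rfl | rfl | rfl)
    · rfl
    · exact R.src_next d
    · exact R.src_next_symm d

/-- Every predicate on the vertices that is invariant along the edges in `C` is constant. -/
def ConnectedBy (R : RotationSystem D) (C : Set R.Edge) : Prop :=
  ∀ P : R.Vertex → Prop, (∀ d, R.edge d ∈ C → P (R.src d) → P (R.tgt d)) → ∀ u v, P u → P v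

/-- Of the edges of `d` and the two other darts at the same vertex of a cubic map, exactly two
are in `C`. -/
def TwoOfThree (R : RotationSystem D) (C : Set R.Edge) (d : D) : Prop :=
  (R.edge d ∈ C ∧ (R.edge (R.next d) ∈ C ↔ R.edge (R.next⁻¹ d) ∉ C)) ∨
    (R.edge d ∉ C ∧ R.edge (R.next d) ∈ C ∧ R.edge (R.next⁻¹ d) ∈ C)

theorem IsCubic.twoOfThree_next (h3 : R.IsCubic) {C : Set R.Edge} {d : D}
    (h : R.TwoOfThree C d) : R.TwoOfThree C (R.next d) := by
  have e : R.next⁻¹ (R.next d) = d := by simp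
  rw [TwoOfThree, ← h3.next_symm, e]
  rw [TwoOfThree] at h
  tauto

theorem adj_restrict_graph_iff (R : RotationSystem D) (C : Set R.Edge) (x y : R.Vertex) :
    (R.graph.restrict C).Adj x y ↔ ∃ d, R.edge d ∈ C ∧ R.src d = x ∧ R.tgt d = y := by
  constructor
  · rintro ⟨e, he, d, rfl, rfl, rfl⟩
    exact ⟨d, he, rfl, rfl⟩
  · rintro ⟨d, hd, rfl, rfl⟩
    exact ⟨_, hd, d, rfl, rfl, rfl⟩

theorem edge_mem_edgeSet_graph (R : RotationSystem D) (e : R.Edge) : e ∈ R.graph.edgeSet := by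
  obtain ⟨d, rfl⟩ := R.exists_edge_eq e
  exact R.graph.edge_mem_iff_exists_isLink _ |>.2 ⟨_, _, d, rfl, rfl, rfl⟩

theorem src_ne_tgt_of_bipartite (hbip : MultiGraph.Bipartite R.graph) (d : D) :
    R.src d ≠ R.tgt d := fun h => by
  obtain ⟨s, hs⟩ := hbip
  exact hs (R.src d) (R.tgt d) ⟨R.edge d, d, rfl, rfl, rfl⟩ (congrArg s h)

/-- Without loops the three darts at a vertex lie on three different edges, so the degree counts how
many of these belong to `C`. -/
theorem degree_restrict_eq_two_iff (h3 : R.IsCubic) (hl : ∀ d, R.src d ≠ R.tgt d) (C : Set R.Edge)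
    (d : D) : MultiGraph.degree (R.graph.restrict C) (R.src d) = 2 ↔ R.TwoOfThree C d := by
  classical
  have hloop : (R.graph.restrict C).loopSet (R.src d) = ∅ := by
    rw [Set.eq_empty_iff_forall_notMem]
    rintro e ⟨-, d', -, h1, h2⟩
    exact hl d' (h1.trans h2.symm)
  have hne : ∀ x y, R.src x = R.src y → x ≠ y → R.edge x ≠ R.edge y := by
    intro x y h1 h2 h4
    rcases (R.edge_eq_iff _ _).1 h4 with h5 | h5
    · exact h2 h5
    · exact hl y (by rw [← h1, h5, R.src_flip])
  have n1 := hne (R.next d) d (R.src_next d) (h3 d).1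
  have n2 := hne (R.next⁻¹ d) d (R.src_next_symm d) (h3.next_symm_ne d)
  have n3 := hne (R.next d) (R.next⁻¹ d) ((R.src_next d).trans (R.src_next_symm d).symm)
    (h3.next_ne_next_symm d)
  have hinc : (R.graph.restrict C).incidenceSet (R.src d) =
      (({R.edge d, R.edge (R.next d), R.edge (R.next⁻¹ d)} : Finset R.Edge).filter (· ∈ C) :
        Finset R.Edge) := by
    ext e
    simp only [Finset.coe_filter, Finset.mem_insert, Finset.mem_singleton, Set.mem_ofPred_eq]
    constructor
    · rintro ⟨y, he, d', rfl, h1, -⟩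
      refine ⟨?_, he⟩
      rcases (h3.src_eq_iff d' d).1 h1 with rfl | rfl | rfl <;> simp
    · rintro ⟨rfl | rfl | rfl, he⟩
      · exact ⟨_, he, _, rfl, rfl, rfl⟩
      · exact ⟨_, he, _, rfl, R.src_next d, rfl⟩
      · exact ⟨_, he, _, rfl, R.src_next_symm d, rfl⟩
  rw [MultiGraph.degree, hloop, hinc, Set.encard_empty, add_zero, Set.encard_coe_eq_coe_finsetCard,
    TwoOfThree]
  generalize R.edge d = x at *
  generalize R.edge (R.next d) = y at *
  generalize R.edge (R.next⁻¹ d) = z at *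
  by_cases a : x ∈ C <;> by_cases b : y ∈ C <;> by_cases c : z ∈ C <;>
    simp [Finset.filter_insert, Finset.filter_singleton, a, b, c, n1.symm, n2.symm, n3]

theorem isHamiltonianCycle_iff [Nonempty D] (h3 : R.IsCubic) (hl : ∀ d, R.src d ≠ R.tgt d)
    (C : Set R.Edge) :
    MultiGraph.IsHamiltonianCycle R.graph C ↔ (∀ d, R.TwoOfThree C d) ∧ R.ConnectedBy C := by
  rw [MultiGraph.IsHamiltonianCycle, MultiGraph.connected_iff_forall_invariant]
  have h1 : C ⊆ R.graph.edgeSet := fun e _ => R.edge_mem_edgeSet_graph e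
  have h2 : (R.graph.restrict C).vertexSet.Nonempty := ⟨R.src (Classical.arbitrary D), trivial⟩
  simp only [h1, h2, true_and, adj_restrict_graph_iff]
  rw [and_comm]
  refine and_congr ⟨fun h d => (degree_restrict_eq_two_iff h3 hl C d).1 (h _ trivial),
    fun h v _ => ?_⟩ ⟨fun h P hP u v => h P ?_ u trivial v trivial, fun h P hP u _ v _ =>
      h P (fun d hd => hP _ _ ⟨d, hd, rfl, rfl⟩) u v⟩
  · obtain ⟨d, rfl⟩ := R.exists_src_eq v
    exact (degree_restrict_eq_two_iff h3 hl C d).2 (h d)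
  · rintro x y ⟨d, hd, rfl, rfl⟩
    exact hP d hd

/-! ### Colors around a vertex -/

/-- The three face corners at a vertex have pairwise different colors, so one is yellow; the edge
opposite to it is white-blue. -/
theorem exists_isWhiteBlue (h3 : R.IsCubic) {c : R.Face → FaceColor}
    (hc : R.IsProperFaceColoring c) (v : R.Vertex) : ∃ d, R.IsWhiteBlue c d ∧ R.src d = v := by
  obtain ⟨d, rfl⟩ := R.exists_src_eq v
  have h1 := hc d
  have h2 := hc (R.next d)
  have h4 := hc (R.next⁻¹ d)
  have e1 := R.isWhiteBlue_iff h3 hc d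
  have e2 := R.isWhiteBlue_iff h3 hc (R.next d)
  have e3 := R.isWhiteBlue_iff h3 hc (R.next⁻¹ d)
  rw [← h3.next_symm] at e2
  have e4 : R.next (R.next⁻¹ d) = d := by simp
  rw [e4] at e3
  rw [R.right_next] at h2
  rw [← R.left_next_symm] at h1 h4
  rw [h3.next_symm_next_symm] at h4
  have : c (R.left d) = .yellow ∨ c (R.left (R.next d)) = .yellow ∨
      c (R.left (R.next⁻¹ d)) = .yellow := by
    cases h5 : c (R.left d) <;> cases h6 : c (R.left (R.next d)) <;>
      cases h7 : c (R.left (R.next⁻¹ d)) <;> simp_all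
  rcases this with h | h | h
  · exact ⟨_, e3.2 h, R.src_next_symm d⟩
  · exact ⟨_, e1.2 h, rfl⟩
  · exact ⟨_, e2.2 h, R.src_next d⟩

/-- The white-blue edges belong to `C`, and of the two other edges at each vertex, exactly one
does. -/
def IsAlternating (R : RotationSystem D) (c : R.Face → FaceColor) (C : Set R.Edge) : Prop :=
  ∀ d, R.IsWhiteBlue c d → R.edge d ∈ C ∧ (R.edge (R.next d) ∈ C ↔ R.edge (R.next⁻¹ d) ∉ C)

theorem IsAlternating.twoOfThree (h3 : R.IsCubic) {c : R.Face → FaceColor}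
    (hc : R.IsProperFaceColoring c) {C : Set R.Edge} (h : R.IsAlternating c C) (d : D) :
    R.TwoOfThree C d := by
  obtain ⟨d', hd', h1⟩ := exists_isWhiteBlue h3 hc (R.src d)
  have h2 : R.TwoOfThree C d' := Or.inl (h d' hd')
  rcases (h3.src_eq_iff d d').1 h1.symm with rfl | rfl | rfl
  · exact h2
  · exact h3.twoOfThree_next h2
  · rw [h3.next_symm]
    exact h3.twoOfThree_next (h3.twoOfThree_next h2)

theorem isWhiteBlueHamiltonianCycle_iff [Nonempty D] (h3 : R.IsCubic)
    (hl : ∀ d, R.src d ≠ R.tgt d) {c : R.Face → FaceColor} (hc : R.IsProperFaceColoring c)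
    (C : Set R.Edge) :
    R.IsWhiteBlueHamiltonianCycle c C ↔ R.IsAlternating c C ∧ R.ConnectedBy C := by
  rw [IsWhiteBlueHamiltonianCycle, isHamiltonianCycle_iff h3 hl]
  constructor
  · rintro ⟨⟨h1, h2⟩, h4⟩
    refine ⟨fun d hd => ⟨h4 d hd, ?_⟩, h2⟩
    rcases h1 d with h5 | h5
    · exact h5.2
    · exact absurd (h4 d hd) h5.1
  · rintro ⟨h1, h2⟩
    exact ⟨⟨h1.twoOfThree h3 hc, h2⟩, fun d hd => (h1 d hd).1⟩

end RotationSystem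

/-! ### Hamiltonian cycles and connected recolorings -/

namespace RotationSystem

variable {D : Type*} {R : RotationSystem D}

/-- The edges with one side in `X` and the other side outside of `X` are those in `C`. -/
def IsBoundary (R : RotationSystem D) (X : R.Face → Prop) (C : Set R.Edge) : Prop :=
  ∀ d, R.edge d ∈ C ↔ ¬(X (R.left d) ↔ X (R.right d))

theorem sum_coboundary_mul_eq_zero [Finite D] {y : R.Edge → ZMod 2}
    (hy : ∀ d, y (R.edge d) + y (R.edge (R.next d)) + y (R.edge (R.next⁻¹ d)) = 0)
    (k : R.Vertex → ZMod 2) : ∑ e, R.coboundary R.src k e * y e = 0 := by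
  cases nonempty_fintype D
  rw [sum_coboundary_mul]
  have h1 := Equiv.sum_comp R.next fun d => k (R.src d) * y (R.edge d)
  have h2 := Equiv.sum_comp R.next⁻¹ fun d => k (R.src d) * y (R.edge d)
  simp only [R.src_next] at h1
  simp only [R.src_next_symm] at h2
  have h4 : ∑ d, k (R.src d) * y (R.edge d) + ∑ d, k (R.src d) * y (R.edge (R.next d)) +
      ∑ d, k (R.src d) * y (R.edge (R.next⁻¹ d)) = 0 := by
    rw [← Finset.sum_add_distrib, ← Finset.sum_add_distrib]
    refine Finset.sum_eq_zero fun d _ => ?_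
    rw [← mul_add, ← mul_add, hy, mul_zero]
  -- The three sums are equal by reindexing. Their total vanishes and three is odd, so each one
  -- vanishes.
  rw [h1, h2, CharTwo.add_self_eq_zero, zero_add] at h4
  exact h4

theorem exists_isBoundary [Finite D] (hp : R.IsConnectedPlane) {C : Set R.Edge}
    (hC : ∀ d, R.edge d ∈ C ↔ (R.edge (R.next d) ∈ C ↔ R.edge (R.next⁻¹ d) ∉ C)) :
    ∃ X, R.IsBoundary X C := by
  classical
  obtain ⟨x, hx⟩ := hp.exists_boundary (fun e => if e ∈ C then 1 else 0)
    (sum_coboundary_mul_eq_zero fun d => by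
      have := hC d
      by_cases a : R.edge d ∈ C <;> by_cases b : R.edge (R.next d) ∈ C <;>
        by_cases c : R.edge (R.next⁻¹ d) ∈ C <;> simp only [a, b, c, if_true, if_false] <;>
        first | decide | (exfalso; tauto))
  refine ⟨fun f => x f = 1, fun d => ?_⟩
  have key : ∀ a b : ZMod 2, ((a = 1 ↔ b = 1) ↔ a = b) := by decide
  rw [key, ← Ne, ← ZMod.add_eq_one_iff_ne, ← hx d]
  by_cases a : R.edge d ∈ C <;> simp [a]

theorem TwoOfThree.even {C : Set R.Edge} {d : D} (h : R.TwoOfThree C d) :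
    R.edge d ∈ C ↔ (R.edge (R.next d) ∈ C ↔ R.edge (R.next⁻¹ d) ∉ C) := by
  rw [TwoOfThree] at h
  tauto

theorem exists_mem_src_eq {C : Set R.Edge} (h : ∀ d, R.TwoOfThree C d) (v : R.Vertex) :
    ∃ d, R.src d = v ∧ R.edge d ∈ C := by
  obtain ⟨d, rfl⟩ := R.exists_src_eq v
  rcases h d with h1 | h1
  · exact ⟨d, rfl, h1.1⟩
  · exact ⟨_, R.src_next d, h1.2.1⟩

theorem exists_mem_left_eq {C : Set R.Edge} (h : ∀ d, R.TwoOfThree C d) (f : R.Face) :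
    ∃ d, R.left d = f ∧ R.edge d ∈ C := by
  obtain ⟨d, rfl⟩ := R.exists_left_eq f
  rcases h d with h1 | h1
  · exact ⟨d, rfl, h1.1⟩
  · exact ⟨R.flip (R.next d), by rw [left_flip, right_next], by rw [edge_flip]; exact h1.2.1⟩

/-- The part `C'` of `C` at the vertices satisfying `P` is again even, so it bounds a set of faces
`Z`. Across edges outside `C` the set `Z` does not change; if both sides of `C` are connected, `Z`
depends only on the side, and its boundary is empty or all of `C`. -/
theorem connectedBy_of_forall_invariant [Finite D] (hp : R.IsConnectedPlane)
    {C : Set R.Edge} (h2 : ∀ d, R.TwoOfThree C d) {X : R.Face → Prop} (hX : R.IsBoundary X C)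
    (h : ∀ Z : R.Face → Prop, (∀ d, R.edge d ∉ C → Z (R.left d) → Z (R.right d)) →
      ∀ f g, (X f ↔ X g) → Z f → Z g) : R.ConnectedBy C := by
  intro P hP u v hu
  have hP' : ∀ d, R.edge d ∈ C → (P (R.src d) ↔ P (R.tgt d)) := fun d hd =>
    ⟨hP d hd, fun h => by
      rw [← R.tgt_flip]; exact hP (R.flip d) (by rwa [edge_flip]) h⟩
  let C' : Set R.Edge := {e | e ∈ C ∧ ∃ d, R.edge d = e ∧ P (R.src d)}
  have hC' : ∀ d, R.edge d ∈ C' ↔ R.edge d ∈ C ∧ P (R.src d) := by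
    intro d
    refine and_congr_right fun hd => ⟨?_, fun h => ⟨d, rfl, h⟩⟩
    rintro ⟨d', h1, h2⟩
    rcases (R.edge_eq_iff _ _).1 h1 with rfl | rfl
    · exact h2
    · exact (hP' d hd).2 h2
  obtain ⟨Z, hZ⟩ := exists_isBoundary hp (C := C') fun d => by
    have := (h2 d).even
    rw [hC', hC', hC', R.src_next, R.src_next_symm]
    tauto
  have hZX := h Z fun d hd hl => by
    have h1 := hZ d
    rw [hC'] at h1
    tauto
  obtain ⟨d, rfl, hd⟩ := exists_mem_src_eq h2 u
  obtain ⟨d', rfl, hd'⟩ := exists_mem_src_eq h2 v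
  have a1 := (hX d).1 hd
  have a2 := (hX d').1 hd'
  have a3 := (hZ d).1 ((hC' d).2 ⟨hd, hu⟩)
  have a4 : ∀ f g, (X f ↔ X g) → (Z f ↔ Z g) := fun f g hfg =>
    ⟨hZX f g hfg, hZX g f hfg.symm⟩
  refine ((hC' d').1 ((hZ d').2 ?_)).2
  -- `X` changes across `d` and across `d'`, and `Z` is a function of `X`. As `Z` changes across
  -- `d`, it also changes across `d'`.
  have b1 := a4 (R.left d) (R.left d')
  have b2 := a4 (R.left d) (R.right d')
  have b3 := a4 (R.right d) (R.left d')
  have b4 := a4 (R.right d) (R.right d')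
  clear a4 hZX hX hZ h2 hP hP'
  grind

/-- The part `Y` of one side of `C` is followed along `C`: at a vertex the third edge is outside `C`
and has both or neither of its sides in `Y`, so bordering `Y` passes from one edge of `C` to the
next. Every face borders an edge of `C`, so `Y` is the whole side. -/
theorem forall_invariant_of_connectedBy (h3 : R.IsCubic)
    {C : Set R.Edge} (h2 : ∀ d, R.TwoOfThree C d) {X : R.Face → Prop} (hX : R.IsBoundary X C)
    (hC : R.ConnectedBy C) (Z : R.Face → Prop)
    (hZ : ∀ d, R.edge d ∉ C → Z (R.left d) → Z (R.right d)) (f g : R.Face)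
    (hfg : X f ↔ X g) (hf : Z f) : Z g := by
  let Y : R.Face → Prop := fun h => (X h ↔ X f) ∧ Z h
  have hY : ∀ d, R.edge d ∉ C → (Y (R.left d) ↔ Y (R.right d)) := by
    intro d hd
    have h1 := hX d
    have h4 := hZ d hd
    have h5 := hZ (R.flip d) (by rwa [edge_flip])
    rw [right_flip, left_flip] at h5
    simp only [Y]
    clear hX hZ hC h2
    grind
  let cross : D → Prop := fun d => ¬(Y (R.left d) ↔ Y (R.right d))
  have hnext : ∀ d, R.edge d ∈ C → R.edge (R.next d) ∈ C → (cross d ↔ cross (R.next d)) := by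
    intro d h4 h5
    have h6 : R.edge (R.next⁻¹ d) ∉ C := by
      have := h2 d
      rw [TwoOfThree] at this
      tauto
    have h7 := hY _ h6
    rw [← R.left_next_symm (R.next⁻¹ d), h3.next_symm_next_symm, R.left_next_symm] at h7
    simp only [cross, R.right_next]
    clear hY hX hZ hC h2
    grind
  have hcross : ∀ d d', R.src d = R.src d' → R.edge d ∈ C → R.edge d' ∈ C →
      (cross d ↔ cross d') := by
    intro d d' hs hd hd'
    rcases (h3.src_eq_iff d d').1 hs with rfl | rfl | rfl
    · rfl
    · exact (hnext _ hd' hd).symm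
    · have e : R.next (R.next⁻¹ d') = d' := by simp
      have := hnext _ hd (by rwa [e])
      rwa [e] at this
  have hflip : ∀ d, cross (R.flip d) ↔ cross d := by
    intro d
    simp only [cross, left_flip, right_flip]
    exact not_congr iff_comm
  obtain ⟨d, rfl, hd⟩ := exists_mem_left_eq h2 f
  obtain ⟨d', rfl, hd'⟩ := exists_mem_left_eq h2 g
  have hcd : cross d := by
    have := (hX d).1 hd
    simp only [cross, Y]
    grind
  have hcd' : cross d' := by
    refine hC (fun v => ∀ d, R.src d = v → R.edge d ∈ C → cross d) ?_ (R.src d) (R.src d')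
      (fun d'' h4 h5 => (hcross _ _ h4 h5 hd).2 hcd) d' rfl hd'
    intro d hd h4 d' h5 hd'
    rw [hcross d' (R.flip d) h5 hd' (by rwa [edge_flip]), hflip]
    exact h4 d rfl hd
  have := (hX d').1 hd'
  simp only [cross, Y] at hcd'
  clear hcross hnext hflip hY hX hZ hC h2 hcd
  grind

theorem connected_induce_dual_iff (S : Set R.Face) :
    MultiGraph.Connected (R.dual.induce S) ↔ S.Nonempty ∧ ∀ P : R.Face → Prop,
      (∀ d, R.left d ∈ S → R.right d ∈ S → P (R.left d) → P (R.right d)) →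
        ∀ f ∈ S, ∀ g ∈ S, P f → P g := by
  rw [MultiGraph.connected_iff_forall_invariant]
  refine and_congr_right fun _ => forall_congr' fun P => imp_congr_left ⟨?_, ?_⟩
  · exact fun h d h1 h2 => h _ _ ⟨R.edge d, ⟨d, rfl, rfl, rfl⟩, h1, h2⟩
  · rintro h x y ⟨e, ⟨d, rfl, rfl, rfl⟩, h1, h2⟩
    exact h d h1 h2

/-- `a` recolors every yellow face white or blue and keeps all other colors. -/
def IsRecoloring (c a : R.Face → FaceColor) : Prop :=
  (∀ f, c f ≠ FaceColor.yellow → a f = c f) ∧ ∀ f, a f ≠ FaceColor.yellow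

/-- At a vertex the white and the blue face keep different colors, and the yellow face takes one of
the two. It then differs from exactly one of its neighbors there. -/
theorem IsRecoloring.isAlternating (h3 : R.IsCubic) {c a : R.Face → FaceColor}
    (hc : R.IsProperFaceColoring c) (ha : IsRecoloring c a) {C : Set R.Edge}
    (hC : R.IsBoundary (fun f => a f = FaceColor.white) C) : R.IsAlternating c C := by
  replace hC : ∀ d, R.edge d ∈ C ↔ ¬(a (R.left d) = .white ↔ a (R.right d) = .white) := hC
  intro d hd
  have h1 := (R.isWhiteBlue_iff h3 hc d).1 hd
  have a1 := ha.1 (R.left d)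
  have a2 := ha.1 (R.right d)
  have a4 := ha.2 (R.left (R.next d))
  rw [hC, hC, hC, R.right_next, ← R.left_next_symm (R.next⁻¹ d), h3.next_symm_next_symm,
    R.left_next_symm]
  rcases hd with ⟨h4, h5⟩ | ⟨h4, h5⟩ <;> rw [h4] at a1 <;> rw [h5] at a2 <;>
    rw [a1 (by simp), a2 (by simp)] <;> cases h6 : a (R.left (R.next d)) <;> simp_all

theorem IsRecoloring.white_or_blue {c a : R.Face → FaceColor} (ha : IsRecoloring c a)
    (f : R.Face) : a f = FaceColor.white ∨ a f = FaceColor.blue := by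
  have := ha.2 f
  cases h : a f <;> simp_all

theorem IsConnectedRecoloring.isRecoloring {c a : R.Face → FaceColor}
    (ha : R.IsConnectedRecoloring c a) : IsRecoloring c a := ⟨ha.1, ha.2.1⟩

theorem IsConnectedRecoloring.connectedBy [Finite D] (hp : R.IsConnectedPlane) (h3 : R.IsCubic)
    {c a : R.Face → FaceColor} (hc : R.IsProperFaceColoring c) (ha : R.IsConnectedRecoloring c a)
    {C : Set R.Edge} (hC : R.IsBoundary (fun f => a f = FaceColor.white) C) :
    R.ConnectedBy C := by
  refine connectedBy_of_forall_invariant hp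
    ((ha.isRecoloring.isAlternating h3 hc hC).twoOfThree h3 hc) hC fun Z hZ f g hfg => ?_
  replace hC : ∀ d, R.edge d ∈ C ↔ ¬(a (R.left d) = .white ↔ a (R.right d) = .white) := hC
  have key : ∀ d, a (R.left d) = a (R.right d) → Z (R.left d) → Z (R.right d) := fun d hd =>
    hZ d (by rw [hC, hd]; simp)
  rcases ha.isRecoloring.white_or_blue f with h | h
  · exact ((connected_induce_dual_iff _).1 ha.2.2.1).2 Z
      (fun d h1 h2 => key d (h1.trans h2.symm)) f h g (hfg.1 h)
  · refine ((connected_induce_dual_iff _).1 ha.2.2.2).2 Z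
      (fun d h1 h2 => key d (h1.trans h2.symm)) f h g ?_
    rcases ha.isRecoloring.white_or_blue g with h1 | h1
    · rw [hfg.2 h1] at h; simp at h
    · exact h1

theorem IsRecoloring.isConnectedRecoloring (h3 : R.IsCubic)
    {c a : R.Face → FaceColor} (hc : R.IsProperFaceColoring c) (ha : IsRecoloring c a)
    {C : Set R.Edge} (hC : R.IsBoundary (fun f => a f = FaceColor.white) C)
    (h : R.ConnectedBy C) (hw : ∃ f, a f = FaceColor.white) (hb : ∃ f, a f = FaceColor.blue) :
    R.IsConnectedRecoloring c a := by
  have key := forall_invariant_of_connectedBy h3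
    ((ha.isAlternating h3 hc hC).twoOfThree h3 hc) hC h
  replace hC : ∀ d, R.edge d ∈ C ↔ ¬(a (R.left d) = .white ↔ a (R.right d) = .white) := hC
  refine ⟨ha.1, ha.2, ?_, ?_⟩ <;> rw [connected_induce_dual_iff]
  · refine ⟨hw, fun P hP f hf g hg hPf => ?_⟩
    refine (key (fun f => a f = .white ∧ P f) (fun d hd h1 => ?_) f g
      ⟨fun _ => hg, fun _ => hf⟩ ⟨hf, hPf⟩).2
    rw [hC, not_not] at hd
    exact ⟨hd.1 h1.1, hP d h1.1 (hd.1 h1.1) h1.2⟩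
  · refine ⟨hb, fun P hP f hf g hg hPf => ?_⟩
    have hf' : a f = .blue := hf
    have hg' : a g = .blue := hg
    refine (key (fun f => a f = .blue ∧ P f) (fun d hd h1 => ?_) f g
      (by rw [hf', hg']) ⟨hf, hPf⟩).2
    rw [hC, not_not] at hd
    have h4 : a (R.right d) = .blue := (ha.white_or_blue _).resolve_left fun h4 => by
      have := hd.2 h4
      rw [h1.1] at this
      simp at this
    exact ⟨h4, hP d h1.1 h4 h1.2⟩

/-! ### From alternating cycles back to recolorings -/

theorem left_next_eq_white (h3 : R.IsCubic) {c : R.Face → FaceColor}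
    (hc : R.IsProperFaceColoring c) {d : D} (hl : c (R.left d) ≠ .white)
    (hr : c (R.right d) ≠ .white) : c (R.left (R.next d)) = .white := by
  have h1 := hc d
  have h2 := hc (R.next d)
  have h4 := hc (R.next⁻¹ d)
  rw [R.right_next] at h2
  rw [← R.left_next_symm (R.next⁻¹ d), h3.next_symm_next_symm, R.left_next_symm] at h4
  cases h5 : c (R.left d) <;> cases h6 : c (R.left (R.next d)) <;>
    cases h7 : c (R.right d) <;> simp_all

theorem exists_isWhiteBlue_left (h3 : R.IsCubic) {c : R.Face → FaceColor}
    (hc : R.IsProperFaceColoring c) {f : R.Face} (hf : c f = .blue) :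
    ∃ d, R.left d = f ∧ c (R.right d) = .white := by
  obtain ⟨d, rfl⟩ := R.exists_left_eq f
  by_cases h : c (R.right d) = .white
  · exact ⟨d, rfl, h⟩
  · exact ⟨R.flip (R.next d), by rw [left_flip, right_next],
      by rw [right_flip]; exact left_next_eq_white h3 hc (by simp [hf]) h⟩

/-- Walking along `C`, the white face at one end of an edge lies on the same side as the white face
at the other end; since `C` reaches every vertex, all white faces are on one side. -/
theorem IsAlternating.white_iff_white (h3 : R.IsCubic) {c : R.Face → FaceColor}
    (hc : R.IsProperFaceColoring c) {C : Set R.Edge} (hC : R.IsAlternating c C)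
    (h : R.ConnectedBy C) {X : R.Face → Prop} (hX : R.IsBoundary X C) {f g : R.Face}
    (hf : c f = .white) (hg : c g = .white) (hXf : X f) : X g := by
  -- If `d` separates blue from yellow, the white face opposite to it at its tail meets the blue
  -- face along a white-blue edge, which is in `C`.
  have third : ∀ d, c (R.left d) ≠ .white → c (R.right d) ≠ .white →
      ∀ b, c b = .blue → (b = R.left d ∨ b = R.right d) → ¬(X (R.left (R.next d)) ↔ X b) := by
    intro d hl hr b hb h4
    have hw := left_next_eq_white h3 hc hl hr
    rcases h4 with rfl | rfl
    · have := (hX (R.next d)).1 (hC _ (Or.inl ⟨hw, by rwa [right_next]⟩)).1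
      rwa [right_next] at this
    · have e : R.right (R.next⁻¹ d) = R.left (R.next d) := by
        rw [← R.left_next_symm (R.next⁻¹ d), h3.next_symm_next_symm]
      have := (hX (R.next⁻¹ d)).1
        (hC _ (Or.inr ⟨by rwa [R.left_next_symm], by rwa [e]⟩)).1
      rw [e, R.left_next_symm] at this
      tauto
  obtain ⟨d, rfl⟩ := R.exists_left_eq f
  obtain ⟨d', rfl⟩ := R.exists_left_eq g
  refine h (fun v => ∀ d, R.src d = v → c (R.left d) = .white → X (R.left d)) ?_
    (R.src d) (R.src d') ?_ d' rfl hg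
  · intro d hd hP d' hs hw
    rcases (h3.src_eq_iff d' (R.flip d)).1 hs with rfl | rfl | rfl
    · rw [left_flip, ← R.left_next_symm] at hw ⊢
      exact hP _ (R.src_next_symm d) hw
    -- Here `d` separates blue from yellow, and the white faces at its two ends may differ. By
    -- `third` both lie on the side opposite to the blue face `b` that they have in common as a
    -- neighbor.
    · have a1 := hc (R.flip d)
      have a2 := hc (R.next (R.flip d))
      have a3 := hc (R.next⁻¹ (R.flip d))
      rw [← R.left_next_symm (R.next⁻¹ (R.flip d)), h3.next_symm_next_symm,
        R.left_next_symm, hw, R.right_flip] at a3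
      rw [R.right_next, hw] at a2
      have b1 := left_next_eq_white h3 hc a3 a2.symm
      have b2 := hP _ (R.src_next d) b1
      rw [right_flip] at a1
      rw [left_flip] at a1 a2
      obtain ⟨b, hb, hb'⟩ : ∃ b, c b = .blue ∧ (b = R.left d ∨ b = R.right d) := by
        cases h5 : c (R.left d)
        · exact absurd h5 a3
        · exact ⟨_, h5, Or.inl rfl⟩
        · cases h6 : c (R.right d)
          · exact absurd h6.symm a2
          · exact ⟨_, h6, Or.inr rfl⟩
          · exact absurd (h6.trans h5.symm) a1
      have c1 := third d a3 a2.symm b hb hb'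
      have c2 := third (R.flip d) a2.symm (by rwa [right_flip]) b hb
        (by rw [right_flip, left_flip]; exact hb'.symm)
      tauto
    · rw [R.left_next_symm, right_flip] at hw ⊢
      exact hP d rfl hw
  · intro d'' hs hw
    rcases (h3.src_eq_iff d'' d).1 hs with rfl | rfl | rfl
    · exact hXf
    · exact absurd (hw.trans hf.symm) (by rw [← R.right_next d]; exact hc _)
    · exact absurd (hw.trans hf.symm) (by rw [R.left_next_symm]; exact (hc _).symm)

/-- An alternating set is even and so has two sides. The white faces share a side, and each blue
face meets a white one across an edge of `C`; coloring the sides thus changes only yellow faces. -/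
theorem IsAlternating.exists_isConnectedRecoloring [Finite D] (hp : R.IsConnectedPlane)
    (h3 : R.IsCubic) {c : R.Face → FaceColor} (hc : R.IsProperFaceColoring c) {C : Set R.Edge}
    (hC : R.IsAlternating c C) (h : R.ConnectedBy C) {outer : R.Face}
    (hout : c outer = .white) :
    ∃ a, R.IsConnectedRecoloring c a ∧ R.IsBoundary (fun f => a f = .white) C := by
  classical
  have h2 := hC.twoOfThree h3 hc
  obtain ⟨X, hX⟩ := exists_isBoundary hp fun d => (h2 d).even
  have hww : ∀ f, c f = .white → (X f ↔ X outer) := fun f hf =>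
    ⟨hC.white_iff_white h3 hc h hX hf hout, hC.white_iff_white h3 hc h hX hout hf⟩
  have hbb : ∀ f, c f = .blue → ¬(X f ↔ X outer) := by
    intro f hf
    obtain ⟨d, rfl, hd⟩ := exists_isWhiteBlue_left h3 hc hf
    have := (hX d).1 (hC _ (Or.inr ⟨hf, hd⟩)).1
    have := hww _ hd
    tauto
  -- `X` is determined only up to complement; comparing with the exterior face makes that side
  -- white.
  let a : R.Face → FaceColor := fun f => if X f ↔ X outer then .white else .blue
  have haw : ∀ f, a f = .white ↔ (X f ↔ X outer) := by
    intro f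
    by_cases h : X f ↔ X outer <;> simp [a, h]
  have hab : ∀ f, a f = .blue ↔ ¬(X f ↔ X outer) := by
    intro f
    by_cases h : X f ↔ X outer <;> simp [a, h]
  have hCa : R.IsBoundary (fun f => a f = .white) C := by
    intro d
    simp only [hX d, haw]
    tauto
  have ha : IsRecoloring c a := by
    refine ⟨fun f hf => ?_, fun f => ?_⟩
    · cases h5 : c f
      · exact (haw f).2 (hww f h5)
      · exact (hab f).2 (hbb f h5)
      · exact absurd h5 hf
    · by_cases h : X f ↔ X outer <;> simp [a, h]
  refine ⟨a, ha.isConnectedRecoloring h3 hc hCa h ⟨outer, (haw _).2 Iff.rfl⟩ ?_, hCa⟩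
  obtain ⟨d, hd, hd'⟩ := exists_mem_left_eq h2 outer
  refine ⟨R.right d, (hab _).2 ?_⟩
  have := (hX d).1 hd'
  rw [hd] at this
  tauto

/-- A path that avoids `C` never leaves the white region of the exterior face, and this region is
connected, so all of it is reached. -/
theorem IsConnectedRecoloring.isInside_iff {c a : R.Face → FaceColor}
    (ha : R.IsConnectedRecoloring c a) {C : Set R.Edge}
    (hC : R.IsBoundary (fun f => a f = .white) C) {outer : R.Face} (hout : c outer = .white)
    (f : R.Face) : R.IsInside outer C f ↔ a f ≠ .white := by
  replace hC : ∀ d, R.edge d ∈ C ↔ ¬(a (R.left d) = .white ↔ a (R.right d) = .white) := hC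
  have hw : a outer = .white := by rw [ha.1 outer (by simp [hout]), hout]
  refine not_congr ⟨fun h => ?_, fun h => ?_⟩
  · induction h with
    | refl => exact hw
    | tail h1 h2 ih =>
      obtain ⟨e, ⟨d, rfl, rfl, rfl⟩, hd⟩ := h2
      rw [hC, not_not] at hd
      exact hd.1 ih
  · refine ((connected_induce_dual_iff _).1 ha.2.2.1).2
      (Relation.ReflTransGen (R.dual.deleteEdges C).Adj outer) (fun d h1 h2 h4 => h4.tail ?_)
      outer hw f h .refl
    have h1' : a (R.left d) = .white := h1
    have h2' : a (R.right d) = .white := h2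
    exact ⟨R.edge d, ⟨d, rfl, rfl, rfl⟩, by rw [hC, h1', h2']; simp⟩

/-- A white-blue edge outside `C` would be a passage from an outer white face to an enclosed blue
one. Conversely, the recoloring given by `C` has the outside as its white region. -/
theorem isSeparatingHamiltonianCycle_iff [Finite D] (hp : R.IsConnectedPlane)
    (h3 : R.IsCubic) (hl : ∀ d, R.src d ≠ R.tgt d) {c : R.Face → FaceColor}
    (hc : R.IsProperFaceColoring c) {outer : R.Face} (hout : c outer = .white) (C : Set R.Edge) :
    R.IsSeparatingHamiltonianCycle outer c C ↔ R.IsWhiteBlueHamiltonianCycle c C := by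
  have := hp.nonempty
  constructor
  · rintro ⟨h1, h2, h4⟩
    refine ⟨h1, fun d hd => ?_⟩
    by_contra hC
    have key : ∀ d, R.edge d ∉ C → c (R.left d) = .white → c (R.right d) = .blue → False :=
      fun d hd hw hb => h2 _ hb ((not_not.1 (h4 _ hw)).tail ⟨R.edge d, ⟨d, rfl, rfl, rfl⟩, hd⟩)
    rcases hd with hd | hd
    · exact key d hC hd.1 hd.2
    · exact key (R.flip d) (by rwa [edge_flip]) hd.2 (by rw [right_flip]; exact hd.1)
  · intro h
    refine ⟨h.1, ?_⟩
    rw [isWhiteBlueHamiltonianCycle_iff h3 hl hc] at h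
    obtain ⟨a, ha, hC⟩ := h.1.exists_isConnectedRecoloring hp h3 hc h.2 hout
    refine ⟨fun f hf => ?_, fun f hf => ?_⟩ <;> rw [ha.isInside_iff hC hout] <;>
      rw [ha.1 f (by simp [hf]), hf] <;> simp

/-- The edges with different values on their two sides. -/
def boundary {γ : Type*} (R : RotationSystem D) (a : R.Face → γ) : Set R.Edge :=
  {e | ∃ d, R.edge d = e ∧ a (R.left d) ≠ a (R.right d)}

theorem edge_mem_boundary {γ : Type*} (a : R.Face → γ) (d : D) :
    R.edge d ∈ R.boundary a ↔ a (R.left d) ≠ a (R.right d) := by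
  refine ⟨?_, fun h => ⟨d, rfl, h⟩⟩
  rintro ⟨d', h1, h2⟩
  rcases (R.edge_eq_iff _ _).1 h1 with rfl | rfl
  · exact h2
  · rw [left_flip, right_flip] at h2
    exact h2.symm

theorem IsRecoloring.isBoundary_iff {c a : R.Face → FaceColor} (ha : IsRecoloring c a)
    (C : Set R.Edge) : R.IsBoundary (fun f => a f = .white) C ↔ C = R.boundary a := by
  have key : ∀ d, ¬(a (R.left d) = .white ↔ a (R.right d) = .white) ↔
      a (R.left d) ≠ a (R.right d) := fun d => by
    rcases ha.white_or_blue (R.left d) with h | h <;>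
      rcases ha.white_or_blue (R.right d) with h' | h' <;> simp [h, h']
  constructor
  · intro h
    ext e
    obtain ⟨d, rfl⟩ := R.exists_edge_eq e
    rw [h, edge_mem_boundary, key]
  · rintro rfl d
    rw [edge_mem_boundary, key]

end RotationSystem

/-! ### Directed Hamiltonian cycles -/

namespace RotationSystem

variable {D : Type*} {R : RotationSystem D}

theorem IsWhiteBlue.left_next (h3 : R.IsCubic) {c : R.Face → FaceColor}
    (hc : R.IsProperFaceColoring c) {d : D} (hd : R.IsWhiteBlue c d) :
    c (R.left (R.next d)) = .yellow := (R.isWhiteBlue_iff h3 hc d).1 hd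

theorem IsWhiteBlue.mem_orientation_iff {c : R.Face → FaceColor} {d : D}
    (hd : R.IsWhiteBlue c d) : d ∈ R.orientation c ↔ c (R.left d) = .white := by
  simp only [orientation, Set.mem_ofPred_eq]
  rcases hd with hd | hd <;> simp [hd]

theorem IsWhiteBlue.next_mem_orientation_iff (h3 : R.IsCubic) {c : R.Face → FaceColor}
    (hc : R.IsProperFaceColoring c) {d : D} (hd : R.IsWhiteBlue c d) :
    R.next d ∈ R.orientation c ↔ c (R.left d) ≠ .white := by
  simp only [orientation, Set.mem_ofPred_eq, R.right_next, hd.left_next h3 hc]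
  rcases hd with hd | hd <;> simp [hd]

theorem IsCubic.right_next_symm (h3 : R.IsCubic) (d : D) :
    R.right (R.next⁻¹ d) = R.left (R.next d) := by
  rw [← R.left_next_symm (R.next⁻¹ d), h3.next_symm_next_symm]

theorem IsWhiteBlue.next_symm_mem_orientation_iff (h3 : R.IsCubic) {c : R.Face → FaceColor}
    (hc : R.IsProperFaceColoring c) {d : D} (hd : R.IsWhiteBlue c d) :
    R.next⁻¹ d ∈ R.orientation c ↔ c (R.left d) ≠ .white := by
  simp only [orientation, Set.mem_ofPred_eq, R.left_next_symm, h3.right_next_symm,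
    hd.left_next h3 hc]
  rcases hd with hd | hd <;> simp [hd]

theorem existsUnique_src_iff (h3 : R.IsCubic) (A : Set D) (d : D) :
    (∃! x, x ∈ A ∧ R.src x = R.src d) ↔
      (d ∈ A ∧ R.next d ∉ A ∧ R.next⁻¹ d ∉ A) ∨ (d ∉ A ∧ (R.next d ∈ A ↔ R.next⁻¹ d ∉ A)) := by
  have n1 := (h3 d).1
  have n2 := h3.next_symm_ne d
  have n3 := h3.next_ne_next_symm d
  have e1 := R.src_next d
  have e2 := R.src_next_symm d
  have key := fun x => h3.src_eq_iff x d
  constructor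
  · rintro ⟨x, ⟨hx, hs⟩, hu⟩
    have u0 := fun h => hu d ⟨h, rfl⟩
    have u1 := fun h => hu _ ⟨h, e1⟩
    have u2 := fun h => hu _ ⟨h, e2⟩
    rcases (key x).1 hs with rfl | rfl | rfl
    · exact Or.inl ⟨hx, fun h => n1 (u1 h), fun h => n2 (u2 h)⟩
    · exact Or.inr ⟨fun h => n1 (u0 h).symm, fun _ h => n3 (u2 h).symm, fun _ => hx⟩
    · exact Or.inr ⟨fun h => n2 (u0 h).symm, fun h => absurd (u1 h) n3, fun h => absurd hx h⟩
  · rintro (⟨h0, h1, h2⟩ | ⟨h0, h1⟩)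
    · refine ⟨d, ⟨h0, rfl⟩, ?_⟩
      rintro x ⟨hx, hs⟩
      rcases (key x).1 hs with rfl | rfl | rfl
      · rfl
      · exact absurd hx h1
      · exact absurd hx h2
    · by_cases h2 : R.next d ∈ A
      · refine ⟨_, ⟨h2, e1⟩, ?_⟩
        rintro x ⟨hx, hs⟩
        rcases (key x).1 hs with rfl | rfl | rfl
        · exact absurd hx h0
        · rfl
        · exact absurd hx (h1.1 h2)
      · refine ⟨_, ⟨not_not.1 fun h4 => h2 (h1.2 h4), e2⟩, ?_⟩
        rintro x ⟨hx, hs⟩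
        rcases (key x).1 hs with rfl | rfl | rfl
        · exact absurd hx h0
        · exact absurd hx h2
        · rfl

theorem existsUnique_tgt_iff (A : Set D) (v : R.Vertex) :
    (∃! x, x ∈ A ∧ R.tgt x = v) ↔ ∃! x, x ∈ R.flip ⁻¹' A ∧ R.src x = v := by
  constructor
  · rintro ⟨x, ⟨h1, h2⟩, h4⟩
    refine ⟨R.flip x, ⟨by rwa [Set.mem_preimage, R.flip_flip], h2⟩, ?_⟩
    rintro y ⟨h5, h6⟩
    rw [← h4 (R.flip y) ⟨h5, by rwa [R.tgt_flip]⟩, R.flip_flip]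
  · rintro ⟨x, ⟨h1, h2⟩, h4⟩
    refine ⟨R.flip x, ⟨h1, by rwa [R.tgt_flip]⟩, ?_⟩
    rintro y ⟨h5, h6⟩
    rw [← h4 (R.flip y) ⟨by rwa [Set.mem_preimage, R.flip_flip], h6⟩, R.flip_flip]

theorem edge_mem_image_iff {O A : Set D} (hO : ∀ d, d ∈ O ↔ R.flip d ∉ O) (hA : A ⊆ O) {d : D}
    (hd : d ∈ O) : R.edge d ∈ R.edge '' A ↔ d ∈ A := by
  refine ⟨?_, Set.mem_image_of_mem _⟩
  rintro ⟨x, hx, h⟩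
  rcases (R.edge_eq_iff _ _).1 h with rfl | rfl
  · exact hx
  · exact absurd (hA hx) ((hO d).1 hd)

/-- A set of arcs of the orientation has one arc out of and one arc
into every vertex exactly if its edges alternate. -/
theorem isAlternating_image_iff (h3 : R.IsCubic) {c : R.Face → FaceColor}
    (hc : R.IsProperFaceColoring c) {A : Set D} (hA : A ⊆ R.orientation c) :
    R.IsAlternating c (R.edge '' A) ↔
      (∀ v, ∃! d, d ∈ A ∧ R.src d = v) ∧ ∀ v, ∃! d, d ∈ A ∧ R.tgt d = v := by
  have hO := R.mem_orientation_iff hc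
  have hm : ∀ d, R.edge d ∈ R.edge '' A ↔ (d ∈ R.orientation c ∧ d ∈ A) ∨
      (d ∉ R.orientation c ∧ R.flip d ∈ A) := by
    intro d
    by_cases hd : d ∈ R.orientation c
    · simp [edge_mem_image_iff hO hA hd, hd]
    · have h1 : R.flip d ∈ R.orientation c := by
        rw [hO, R.flip_flip]; exact hd
      rw [← R.edge_flip, edge_mem_image_iff hO hA h1]
      simp [hd]
  have hA' : ∀ d, d ∈ A → d ∈ R.orientation c := fun d h => hA h
  have hAf : ∀ d, R.flip d ∈ A → d ∉ R.orientation c := fun d h => by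
    have := (hO _).1 (hA h)
    rwa [R.flip_flip] at this
  -- The white-blue edge points out of the vertex exactly if both other edges point into it. One arc
  -- out and one arc in therefore means the white-blue edge and one of the others.
  have key : ∀ d, R.IsWhiteBlue c d →
      ((R.edge d ∈ R.edge '' A ∧
        (R.edge (R.next d) ∈ R.edge '' A ↔ R.edge (R.next⁻¹ d) ∉ R.edge '' A)) ↔
      (∃! x, x ∈ A ∧ R.src x = R.src d) ∧ ∃! x, x ∈ A ∧ R.tgt x = R.src d) := by
    intro d hd
    rw [existsUnique_tgt_iff, existsUnique_src_iff h3, existsUnique_src_iff h3, hm, hm, hm]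
    simp only [Set.mem_preimage]
    have o0 := hd.mem_orientation_iff
    have o1 := hd.next_mem_orientation_iff h3 hc
    have o2 := hd.next_symm_mem_orientation_iff h3 hc
    have a0 := hA' d
    have a1 := hA' (R.next d)
    have a2 := hA' (R.next⁻¹ d)
    have b0 := hAf d
    have b1 := hAf (R.next d)
    have b2 := hAf (R.next⁻¹ d)
    clear hm hA hA' hAf hO hd
    grind
  constructor
  · intro h
    refine ⟨fun v => ?_, fun v => ?_⟩ <;> obtain ⟨d, hd, rfl⟩ := exists_isWhiteBlue h3 hc v
    · exact ((key d hd).1 (h d hd)).1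
    · exact ((key d hd).1 (h d hd)).2
  · rintro ⟨h1, h2⟩ d hd
    exact (key d hd).2 ⟨h1 _, h2 _⟩

/-- Following the arcs permutes the finite vertex set, so a set closed under successors is also
closed under predecessors. Undirected connectedness then gives directed reachability. -/
theorem connectedBy_image_iff [Finite D] {A : Set D} (h1 : ∀ v, ∃! d, d ∈ A ∧ R.src d = v)
    (h2 : ∀ v, ∃! d, d ∈ A ∧ R.tgt d = v) :
    R.ConnectedBy (R.edge '' A) ↔
      ∀ u v, Relation.ReflTransGen (fun x y => ∃ d ∈ A, R.src d = x ∧ R.tgt d = y) u v := by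
  constructor
  · intro h u
    choose s hs using fun v => (h1 v).exists
    have hinj : Function.Injective fun v => R.tgt (s v) := by
      intro v w hvw
      have := (h2 (R.tgt (s v))).unique ⟨(hs v).1, rfl⟩ ⟨(hs w).1, hvw.symm⟩
      rw [← (hs v).2, ← (hs w).2, this]
    let S : Set R.Vertex :=
      {v | Relation.ReflTransGen (fun x y => ∃ d ∈ A, R.src d = x ∧ R.tgt d = y) u v}
    have hmaps : Set.MapsTo (fun v => R.tgt (s v)) S S := fun v hv =>
      Relation.ReflTransGen.tail hv ⟨s v, (hs v).1, (hs v).2, rfl⟩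
    have hsurj := Set.surj_on_of_inj_on_of_ncard_le (s := S) (t := S)
      (fun v _ => R.tgt (s v)) (fun _ hv => hmaps hv)
      (fun v w _ _ h => hinj h) le_rfl
    refine fun v => h (fun v => v ∈ S) ?_ u v Relation.ReflTransGen.refl
    rintro d ⟨d', hd', he⟩ hd
    rcases (R.edge_eq_iff _ _).1 he with rfl | rfl
    · exact Relation.ReflTransGen.tail hd ⟨d', hd', rfl, rfl⟩
    · obtain ⟨w, hw, hwd⟩ := hsurj (R.src d) hd
      have := (h2 (R.src d)).unique ⟨hd', R.tgt_flip d⟩ ⟨(hs w).1, hwd.symm⟩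
      have e : R.tgt d = w := by
        rw [← (hs w).2, ← this, R.src_flip]
      rwa [e]
  · intro h P hP u v hu
    induction h u v with
    | refl => exact hu
    | tail _ h2 ih =>
      obtain ⟨d, hd, rfl, rfl⟩ := h2
      exact hP d ⟨d, hd, rfl⟩ ih

theorem isDirectedHamiltonianCycle_iff [Finite D] [Nonempty D] (h3 : R.IsCubic)
    (hl : ∀ d, R.src d ≠ R.tgt d) {c : R.Face → FaceColor} (hc : R.IsProperFaceColoring c)
    (A : Set D) : R.IsDirectedHamiltonianCycle (R.orientation c) A ↔
      A ⊆ R.orientation c ∧ R.IsWhiteBlueHamiltonianCycle c (R.edge '' A) := by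
  refine and_congr_right fun hA => ?_
  rw [isWhiteBlueHamiltonianCycle_iff h3 hl hc, isAlternating_image_iff h3 hc hA, and_assoc]
  refine and_congr_right fun h1 => and_congr_right fun h2 => ?_
  rw [connectedBy_image_iff h1 h2]

/-- The directed Hamiltonian cycle with the same edges. -/
def directedEquiv [Finite D] [Nonempty D] (h3 : R.IsCubic)
    (hl : ∀ d, R.src d ≠ R.tgt d) {c : R.Face → FaceColor} (hc : R.IsProperFaceColoring c) :
    {C : Set R.Edge // R.IsWhiteBlueHamiltonianCycle c C} ≃
      {A : Set D // R.IsDirectedHamiltonianCycle (R.orientation c) A} :=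
  have himage : ∀ C : Set R.Edge, R.edge '' {d | d ∈ R.orientation c ∧ R.edge d ∈ C} = C := by
    intro C
    ext e
    constructor
    · rintro ⟨d, hd, rfl⟩
      exact hd.2
    · intro he
      obtain ⟨d, rfl⟩ := R.exists_edge_eq e
      by_cases hd : d ∈ R.orientation c
      · exact ⟨d, ⟨hd, he⟩, rfl⟩
      · refine ⟨R.flip d, ⟨?_, by rwa [edge_flip]⟩, R.edge_flip d⟩
        rw [R.mem_orientation_iff hc, R.flip_flip]
        exact hd
  { toFun := fun C => ⟨{d | d ∈ R.orientation c ∧ R.edge d ∈ C.1},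
      (isDirectedHamiltonianCycle_iff h3 hl hc _).2
        ⟨fun _ hd => hd.1, by rw [himage]; exact C.2⟩⟩
    invFun := fun A => ⟨R.edge '' A.1, ((isDirectedHamiltonianCycle_iff h3 hl hc _).1 A.2).2⟩
    left_inv := fun C => Subtype.ext (himage C.1)
    right_inv := fun A => Subtype.ext <| Set.ext fun d =>
      ⟨fun hd => (edge_mem_image_iff (R.mem_orientation_iff hc) A.2.1 hd.1).1 hd.2,
        fun hd => ⟨A.2.1 hd, d, hd, rfl⟩⟩ }

theorem edge_image_directedEquiv [Finite D] [Nonempty D] (h3 : R.IsCubic)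
    (hl : ∀ d, R.src d ≠ R.tgt d) {c : R.Face → FaceColor} (hc : R.IsProperFaceColoring c)
    (C : {C : Set R.Edge // R.IsWhiteBlueHamiltonianCycle c C}) :
    R.edge '' (directedEquiv h3 hl hc C).1 = C.1 :=
  congrArg Subtype.val ((directedEquiv h3 hl hc).symm_apply_apply C)

end RotationSystem

/-! ### Tree-residue vertex-breakings -/

namespace MultiGraph

variable {α β : Type*}

theorem subdivideDelete_adj_iff (H : Graph α β) (S : Set α)
    (p q : {x : α // x ∈ H.vertexSet ∧ x ∉ S} ⊕ {e : β // e ∈ H.edgeSet}) :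
    (subdivideDelete H S).Adj p q ↔ ∃ x e, H.Inc e.1 x.1 ∧
      ((p = Sum.inl x ∧ q = Sum.inr e) ∨ (q = Sum.inl x ∧ p = Sum.inr e)) := by
  rw [subdivideDelete, SimpleGraph.fromRel_adj]
  constructor
  · rintro ⟨-, ⟨x, e, rfl, rfl, h⟩ | ⟨x, e, rfl, rfl, h⟩⟩
    · exact ⟨x, e, h, Or.inl ⟨rfl, rfl⟩⟩
    · exact ⟨x, e, h, Or.inr ⟨rfl, rfl⟩⟩
  · rintro ⟨x, e, h, ⟨rfl, rfl⟩ | ⟨rfl, rfl⟩⟩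
    · exact ⟨by simp, Or.inl ⟨x, e, rfl, rfl, h⟩⟩
    · exact ⟨by simp, Or.inr ⟨x, e, rfl, rfl, h⟩⟩

end MultiGraph

theorem SimpleGraph.Reachable.invariant {V : Type*} {G : SimpleGraph V} {P : V → Prop}
    (hP : ∀ u v, G.Adj u v → P u → P v) {u v : V} (h : G.Reachable u v) (hu : P u) : P v := by
  rw [SimpleGraph.reachable_iff_reflTransGen] at h
  induction h with
  | refl => exact hu
  | tail _ h ih => exact hP _ _ h ih

namespace RotationSystem

variable {D : Type*} {R : RotationSystem D}

/-- A chord of a connected spanning set of edges closes a cycle, which has a side. -/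
theorem exists_separation_of_connectedBy [Finite D] (hp : R.IsConnectedPlane) {C : Set R.Edge}
    (hC : R.ConnectedBy C) {d₀ : D} (hd₀ : R.edge d₀ ∉ C) :
    ∃ Z : R.Face → Prop, (∀ d, R.edge d ∉ C → d ≠ d₀ → d ≠ R.flip d₀ →
      (Z (R.left d) ↔ Z (R.right d))) ∧ Z (R.left d₀) ∧ ¬Z (R.right d₀) := by
  classical
  -- The predicate says that some mod 2 chain in `C` has boundary `src d₀ + v`; adding an edge of
  -- `C` carries it from one end of that edge to the other.
  obtain ⟨y, hy, hk⟩ := hC (fun v => ∃ y : R.Edge → ZMod 2, (∀ e ∉ C, y e = 0) ∧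
      ∀ k, ∑ e, R.coboundary R.src k e * y e = k (R.src d₀) + k v) (by
    rintro d hd ⟨y, hy, hk⟩
    refine ⟨y + Pi.single (R.edge d) 1, fun e he => ?_, fun k => ?_⟩
    · have : e ≠ R.edge d := fun h => he (h ▸ hd)
      simp [hy e he, this]
    · simp only [Pi.add_apply, mul_add, Finset.sum_add_distrib, hk]
      rw [Finset.sum_eq_single (R.edge d) (fun e _ he => by simp [he]) (by simp),
        Pi.single_eq_same, mul_one, coboundary_edge, add_assoc, ← add_assoc (k (R.src d)),
        CharTwo.add_self_eq_zero, zero_add, src_flip]) (R.src d₀) (R.tgt d₀)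
    ⟨0, fun _ _ => rfl, fun k => by simp [CharTwo.add_self_eq_zero]⟩
  -- With the chord `d₀` added, the chain closes to a cycle and bounds a set of faces, whose
  -- indicator `x` changes across `d₀`.
  obtain ⟨x, hx⟩ := hp.exists_boundary (y + Pi.single (R.edge d₀) 1) fun k => by
    simp only [Pi.add_apply, mul_add, Finset.sum_add_distrib, hk]
    rw [Finset.sum_eq_single (R.edge d₀) (fun e _ he => by simp [he]) (by simp),
      Pi.single_eq_same, mul_one, coboundary_edge, src_flip, CharTwo.add_self_eq_zero]
  refine ⟨fun f => x f = x (R.left d₀), fun d hd h1 h2 => ?_, rfl, fun h => ?_⟩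
  · have := hx d
    have hne : R.edge d ≠ R.edge d₀ := fun h => (R.edge_eq_iff _ _).1 h |>.elim h1 h2
    rw [Pi.add_apply, hy _ hd, Pi.single_eq_of_ne hne, add_zero, eq_comm,
      ZMod.add_eq_zero_iff_eq_two] at this
    simp only [this]
  · have := hx d₀
    rw [Pi.add_apply, hy _ hd₀, Pi.single_eq_same, zero_add, h, CharTwo.add_self_eq_zero] at this
    exact one_ne_zero this

theorem FaceColor.eq_blue {x y : FaceColor} (h : x ≠ y) (hx : x ≠ .white) (hy : y ≠ .white)
    (hx' : x ≠ .blue) : y = .blue := by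
  cases x <;> cases y <;> simp_all

theorem nonwhiteDual_inc_iff {c : R.Face → FaceColor} (e : R.Edge) (x : R.Face) :
    (R.nonwhiteDual c).Inc e x ↔
      ∃ d, R.edge d = e ∧ R.left d = x ∧ c (R.left d) ≠ .white ∧ c (R.right d) ≠ .white := by
  constructor
  · rintro ⟨y, ⟨d, rfl, rfl, rfl⟩, h1, h2⟩
    exact ⟨d, rfl, rfl, h1, h2⟩
  · rintro ⟨d, rfl, rfl, h1, h2⟩
    exact ⟨_, ⟨d, rfl, rfl, rfl⟩, h1, h2⟩

theorem IsRecoloring.eq_blue_iff {c a : R.Face → FaceColor} (ha : IsRecoloring c a)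
    (f : R.Face) : a f = .blue ↔ c f ≠ .white ∧ f ∉ {f | c f = .yellow ∧ a f = .white} := by
  have h1 := ha.1 f
  have h2 := ha.2 f
  simp only [Set.mem_ofPred_eq]
  cases h4 : c f <;> cases h5 : a f <;> simp_all

/-- The unbroken vertices are the faces blue under `a`, which are connected. An edge between
non-white faces has an originally blue side, so every midpoint is attached to them. -/
theorem IsConnectedRecoloring.subdivideDelete_connected
    {c a : R.Face → FaceColor} (hc : R.IsProperFaceColoring c)
    (ha : R.IsConnectedRecoloring c a) :
    (MultiGraph.subdivideDelete (R.nonwhiteDual c)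
      {f | c f = .yellow ∧ a f = .white}).Connected := by
  set S : Set R.Face := {f | c f = .yellow ∧ a f = .white} with hS
  set T := MultiGraph.subdivideDelete (R.nonwhiteDual c) S with hT
  have hr := ha.isRecoloring
  have hblue := hr.eq_blue_iff
  have hadj : ∀ x e, T.Adj (Sum.inl x) (Sum.inr e) ↔ (R.nonwhiteDual c).Inc e.1 x.1 := by
    intro x e
    rw [hT, MultiGraph.subdivideDelete_adj_iff]
    constructor
    · rintro ⟨x', e', h, ⟨h1, h2⟩ | ⟨h1, h2⟩⟩
      · cases h1; cases h2; exact h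
      · cases h1
    · exact fun h => ⟨x, e, h, Or.inl ⟨rfl, rfl⟩⟩
  obtain ⟨⟨f₀, hf₀⟩, hconnB⟩ := (connected_induce_dual_iff _).1 ha.2.2.2
  have hf₀' : a f₀ = .blue := hf₀
  have hreach : ∀ f (hf : a f = .blue),
      T.Reachable (Sum.inl ⟨f₀, (hblue _).1 hf₀'⟩) (Sum.inl ⟨f, (hblue _).1 hf⟩) := by
    intro f hf
    have := hconnB (fun f => ∀ hf : a f = .blue,
      T.Reachable (Sum.inl ⟨f₀, (hblue _).1 hf₀'⟩) (Sum.inl ⟨f, (hblue _).1 hf⟩)) ?_ f₀ hf₀ f hf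
      fun _ => SimpleGraph.Reachable.refl _
    · exact this hf
    intro d h1 h2 h4 h5
    have c1 := ((hblue _).1 h1).1
    have c2 := ((hblue _).1 h2).1
    have he : R.edge d ∈ (R.nonwhiteDual c).edgeSet :=
      ((nonwhiteDual_inc_iff _ (R.left d)).2 ⟨d, rfl, rfl, c1, c2⟩).edge_mem
    refine (h4 h1).trans (SimpleGraph.Adj.reachable
      ((hadj _ ⟨R.edge d, he⟩).2 ((nonwhiteDual_inc_iff _ _).2 ⟨d, rfl, rfl, c1, c2⟩)) |>.trans
      (SimpleGraph.Adj.reachable (((hadj _ ⟨R.edge d, he⟩).2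
        ((nonwhiteDual_inc_iff _ _).2 ⟨R.flip d, R.edge_flip d, rfl, c2, ?_⟩)).symm)))
    rwa [right_flip]
  refine (SimpleGraph.connected_iff_exists_forall_reachable _).2
    ⟨Sum.inl ⟨f₀, (hblue _).1 hf₀'⟩, ?_⟩
  rintro (⟨f, hf⟩ | ⟨e, he⟩)
  · exact hreach f ((hblue f).2 hf)
  · obtain ⟨x, y, ⟨d, rfl, rfl, rfl⟩, h1, h2⟩ :=
      (R.nonwhiteDual c).exists_isLink_of_mem_edgeSet he
    have h1' : c (R.left d) ≠ .white := h1
    have h2' : c (R.right d) ≠ .white := h2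
    obtain ⟨d', hd', hl, hr'⟩ : ∃ d', R.edge d' = R.edge d ∧ c (R.left d') = .blue ∧
        c (R.right d') ≠ .white := by
      have := hc d
      by_cases h4 : c (R.left d) = .blue
      · exact ⟨d, rfl, h4, h2'⟩
      · refine ⟨R.flip d, R.edge_flip d, ?_, by rwa [right_flip]⟩
        exact FaceColor.eq_blue this h1' h2' h4
    have hb : a (R.left d') = .blue := by rw [hr.1 _ (by simp [hl]), hl]
    exact (hreach _ hb).trans (SimpleGraph.Adj.reachable ((hadj _ _).2
      ((nonwhiteDual_inc_iff _ _).2 ⟨d', hd', rfl, by simp [hl], hr'⟩)))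

/-- An edge with both sides blue under `a` is a chord of the connected boundary. The cycle which it
closes separates its two sides, so each of its halves is a bridge. -/
theorem IsConnectedRecoloring.subdivideDelete_isAcyclic [Finite D] (hp : R.IsConnectedPlane)
    (h3 : R.IsCubic) {c a : R.Face → FaceColor} (hc : R.IsProperFaceColoring c)
    (ha : R.IsConnectedRecoloring c a) :
    (MultiGraph.subdivideDelete (R.nonwhiteDual c)
      {f | c f = .yellow ∧ a f = .white}).IsAcyclic := by
  set S : Set R.Face := {f | c f = .yellow ∧ a f = .white} with hS
  set T := MultiGraph.subdivideDelete (R.nonwhiteDual c) S with hT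
  have hr := ha.isRecoloring
  have hblue := hr.eq_blue_iff
  have hC := (hr.isBoundary_iff _).2 rfl
  have hconn := ha.connectedBy hp h3 hc hC
  have hbridge : ∀ x e, (R.nonwhiteDual c).Inc e.1 x.1 →
      T.IsBridge s(Sum.inl x, Sum.inr e) := by
    rintro ⟨x, hx⟩ ⟨e, he⟩ h
    obtain ⟨d₀, rfl, rfl, h1, h2⟩ := (nonwhiteDual_inc_iff _ _).1 h
    have hx' := (hblue _).2 hx
    obtain ⟨Z, hZ, hZl, hZr⟩ : ∃ Z : R.Face → Prop, (∀ d, a (R.left d) = .blue →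
        a (R.right d) = .blue → d ≠ d₀ → d ≠ R.flip d₀ → (Z (R.left d) ↔ Z (R.right d))) ∧
        Z (R.left d₀) ∧ (a (R.right d₀) = .blue → ¬Z (R.right d₀)) := by
      by_cases hb : a (R.right d₀) = .blue
      · obtain ⟨Z, h4, h5, h6⟩ := exists_separation_of_connectedBy hp hconn (d₀ := d₀)
          (by rw [edge_mem_boundary, hx', hb]; simp)
        exact ⟨Z, fun d h7 h8 => h4 d (by rw [edge_mem_boundary, h7, h8]; simp), h5, fun _ => h6⟩
      -- The far vertex is broken, so the midpoint is a leaf and no separation of faces is needed.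
      · exact ⟨fun _ => True, fun _ _ _ _ _ => Iff.rfl, trivial, fun h => absurd h hb⟩
    rw [SimpleGraph.isBridge_iff]
    intro hreach
    -- `p` extends the side `Z` to midpoints: a midpoint is marked if a half other than `d₀` joins
    -- it to a blue face in `Z`.
    let p : _ → Prop := Sum.elim (fun x : {x // x ∈ (R.nonwhiteDual c).vertexSet ∧ x ∉ S} => Z x.1)
      (fun e : {e // e ∈ (R.nonwhiteDual c).edgeSet} =>
        ∃ d, d ≠ d₀ ∧ R.edge d = e.1 ∧ a (R.left d) = .blue ∧ Z (R.left d))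
    obtain ⟨d, hd, hde, hdb, hdZ⟩ := SimpleGraph.Reachable.invariant (P := p) (by
      intro u v huv
      rw [SimpleGraph.deleteEdges_adj, hT, MultiGraph.subdivideDelete_adj_iff] at huv
      obtain ⟨⟨⟨x, hx⟩, ⟨e, he⟩, hinc, huv⟩, hne⟩ := huv
      obtain ⟨d, rfl, rfl, h4, h5⟩ := (nonwhiteDual_inc_iff _ _).1 hinc
      have hd : d ≠ d₀ := by
        rintro rfl
        rcases huv with ⟨rfl, rfl⟩ | ⟨rfl, rfl⟩
        · exact hne rfl
        · exact hne Sym2.eq_swap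
      have hdb := (hblue _).2 hx
      rcases huv with ⟨rfl, rfl⟩ | ⟨rfl, rfl⟩
      · exact fun hZ' => ⟨d, hd, rfl, hdb, hZ'⟩
      · rintro ⟨d', hd', he', hb', hZ'⟩
        rcases (R.edge_eq_iff _ _).1 he' with rfl | rfl
        · exact hZ'
        · exact (hZ d hdb hb' hd (fun h => hd' (by rw [h, R.flip_flip]))).2 hZ') hreach hZl
    rcases (R.edge_eq_iff _ _).1 hde with rfl | rfl
    · exact hd rfl
    · exact hZr hdb hdZ
  rw [SimpleGraph.isAcyclic_iff_forall_adj_isBridge]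
  intro u v huv
  rw [hT, MultiGraph.subdivideDelete_adj_iff] at huv
  obtain ⟨x, e, h, ⟨rfl, rfl⟩ | ⟨rfl, rfl⟩⟩ := huv
  · exact hbridge x e h
  · rw [Sym2.eq_swap]
    exact hbridge x e h

/-- A predicate `P` invariant along the boundary is shown to be invariant along the edges inside the
blue region too, since these are bridges of the tree. It is then constant around each blue face and
across the tree, and every vertex lies on a blue face. -/
theorem IsRecoloring.connectedBy_of_isTree [Finite D] (h3 : R.IsCubic)
    {c a : R.Face → FaceColor} (hc : R.IsProperFaceColoring c) (ha : IsRecoloring c a)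
    (ht : (MultiGraph.subdivideDelete (R.nonwhiteDual c)
      {f | c f = .yellow ∧ a f = .white}).IsTree) : R.ConnectedBy (R.boundary a) := by
  classical
  set S : Set R.Face := {f | c f = .yellow ∧ a f = .white} with hS
  set T := MultiGraph.subdivideDelete (R.nonwhiteDual c) S with hT
  have hblue := ha.eq_blue_iff
  have hwb := ha.white_or_blue
  have hadj : ∀ d h₁ h₂, c (R.right d) ≠ .white →
      T.Adj (Sum.inl ⟨R.left d, h₁⟩) (Sum.inr ⟨R.edge d, h₂⟩) := by
    intro d h₁ h₂ h4
    rw [hT, MultiGraph.subdivideDelete_adj_iff]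
    exact ⟨_, _, (nonwhiteDual_inc_iff _ _).2 ⟨d, rfl, rfl, h₁.1, h4⟩, Or.inl ⟨rfl, rfl⟩⟩
  intro P hP
  have hP' : ∀ d, R.edge d ∈ R.boundary a → (P (R.src d) ↔ P (R.tgt d)) := fun d hd =>
    ⟨hP d hd, fun h => by
      rw [← R.tgt_flip]; exact hP (R.flip d) (by rwa [edge_flip]) h⟩
  have hchord : ∀ d, a (R.left d) = .blue → a (R.right d) = .blue →
      (P (R.src d) ↔ P (R.tgt d)) := by
    intro d₀ hl hr
    have hl' := (hblue _).1 hl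
    have hr' := (hblue _).1 hr
    have he : R.edge d₀ ∈ (R.nonwhiteDual c).edgeSet :=
      ((nonwhiteDual_inc_iff _ (R.left d₀)).2 ⟨d₀, rfl, rfl, hl'.1, hr'.1⟩).edge_mem
    have hbr := SimpleGraph.isAcyclic_iff_forall_adj_isBridge.1 ht.isAcyclic
      (hadj d₀ hl' he hr'.1)
    rw [SimpleGraph.isBridge_iff] at hbr
    set T' := T.deleteEdges {s(Sum.inl ⟨R.left d₀, hl'⟩, Sum.inr ⟨R.edge d₀, he⟩)} with hT'
    have hadj' : ∀ d h₁ h₂, c (R.right d) ≠ .white → d ≠ d₀ →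
        T'.Adj (Sum.inl ⟨R.left d, h₁⟩) (Sum.inr ⟨R.edge d, h₂⟩) := by
      intro d h₁ h₂ h4 h5
      rw [hT', SimpleGraph.deleteEdges_adj]
      refine ⟨hadj d h₁ h₂ h4, fun h => ?_⟩
      rcases Sym2.eq_iff.1 h with ⟨h6, h7⟩ | ⟨h6, h7⟩
      · have h8 : R.left d = R.left d₀ := congrArg Subtype.val (Sum.inl.inj h6)
        have h9 : R.edge d = R.edge d₀ := congrArg Subtype.val (Sum.inr.inj h7)
        rcases (R.edge_eq_iff _ _).1 h9 with rfl | rfl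
        · exact h5 rfl
        · exact hc d₀ (by rw [← h8, left_flip])
      · cases h6
    -- `Z` is the component of `left d₀` after cutting the tree at a half of `d₀`.
    let Z : R.Face → Prop := fun f => ∃ hf : f ∈ (R.nonwhiteDual c).vertexSet ∧ f ∉ S,
      T'.Reachable (Sum.inl ⟨R.left d₀, hl'⟩) (Sum.inl ⟨f, hf⟩)
    have hZl : Z (R.left d₀) := ⟨hl', SimpleGraph.Reachable.refl _⟩
    have hZr : ¬Z (R.right d₀) := by
      rintro ⟨h1, h2⟩
      refine hbr (h2.trans (SimpleGraph.Adj.reachable ?_))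
      have h4 := hadj' (R.flip d₀) hr' (by rwa [edge_flip]) (by rw [right_flip]; exact hl'.1)
        (R.flip_ne d₀)
      simp only [R.edge_flip] at h4
      exact h4
    have hZ : ∀ d, R.edge d ∉ R.boundary a → R.edge d ≠ R.edge d₀ →
        (Z (R.left d) ↔ Z (R.right d)) := by
      intro d hd hne
      rw [edge_mem_boundary, not_not] at hd
      rcases hwb (R.left d) with h1 | h1
      · have h2 : ∀ f, a f = .white → ¬Z f := fun f hf hZ => by
          have := (hblue f).2 hZ.1
          rw [hf] at this
          cases this
        exact iff_of_false (h2 _ h1) (h2 _ (hd ▸ h1))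
      · have h2 : a (R.right d) = .blue := hd ▸ h1
        have h1' := (hblue _).1 h1
        have h2' := (hblue _).1 h2
        have he' : R.edge d ∈ (R.nonwhiteDual c).edgeSet :=
          ((nonwhiteDual_inc_iff _ (R.left d)).2 ⟨d, rfl, rfl, h1'.1, h2'.1⟩).edge_mem
        have a1 := hadj' d h1' he' h2'.1 fun h => hne (by rw [h])
        have a2 := hadj' (R.flip d) h2' (by rwa [edge_flip]) (by rw [right_flip]; exact h1'.1)
          fun h => hne (by rw [← h, edge_flip])
        simp only [R.edge_flip] at a2
        exact ⟨fun ⟨_, h⟩ => ⟨h2', (h.trans a1.reachable).trans a2.symm.reachable⟩,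
          fun ⟨_, h⟩ => ⟨h1', (h.trans a2.reachable).trans a1.symm.reachable⟩⟩
    -- `P` changes only at edges off the boundary, and among these `Z` changes only at `d₀`.
    -- Orthogonality leaves the single term at `d₀`, which forces `P` to agree at its ends.
    have hsum := R.sum_coboundary_mul_coboundary (fun v => if P v then 1 else 0)
      (fun f => if Z f then 1 else 0)
    rw [Finset.sum_eq_single (R.edge d₀) ?_ (by simp)] at hsum
    · rw [coboundary_edge, coboundary_edge, if_pos hZl, left_flip, if_neg hZr, add_zero, mul_one,
        src_flip] at hsum
      by_cases h1 : P (R.src d₀) <;> by_cases h2 : P (R.tgt d₀) <;> simp_all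
    · intro e _ he
      obtain ⟨d, rfl⟩ := R.exists_edge_eq e
      rw [coboundary_edge, coboundary_edge, left_flip, src_flip]
      by_cases hd : R.edge d ∈ R.boundary a
      · simp only [hP' d hd, CharTwo.add_self_eq_zero, zero_mul]
      · simp only [hZ d hd he, CharTwo.add_self_eq_zero, mul_zero]
  have hedge : ∀ d, a (R.left d) = .blue → (P (R.src d) ↔ P (R.tgt d)) := by
    intro d hd
    by_cases h : R.edge d ∈ R.boundary a
    · exact hP' d h
    · rw [edge_mem_boundary, not_not] at h
      exact hchord d hd (h ▸ hd)
  have hface : ∀ d d', a (R.left d) = .blue → R.left d = R.left d' →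
      (P (R.src d) ↔ P (R.src d')) := by
    intro d d' hd h
    refine R.iff_of_left_eq (P := fun d => P (R.src d)) (fun d'' h1 => ?_) rfl h.symm
    rw [R.src_faceNext]
    exact (hedge d'' (by rw [h1, hd])).symm
  have hleft : ∀ v, ∃ d, R.src d = v ∧ a (R.left d) = .blue := by
    intro v
    obtain ⟨d, hd, rfl⟩ := exists_isWhiteBlue h3 hc v
    rcases hd with hd | hd
    · exact ⟨R.next⁻¹ d, R.src_next_symm d, by
        rw [R.left_next_symm, ha.1 _ (by simp [hd.2]), hd.2]⟩
    · exact ⟨d, rfl, by rw [ha.1 _ (by simp [hd.1]), hd.1]⟩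
  intro u v hu
  obtain ⟨d, rfl, hd⟩ := hleft u
  obtain ⟨d', rfl, hd'⟩ := hleft v
  obtain ⟨d'', h1, h2⟩ := SimpleGraph.Reachable.invariant
    (P := Sum.elim (fun x : {x // x ∈ (R.nonwhiteDual c).vertexSet ∧ x ∉ S} =>
        ∃ d, R.left d = x.1 ∧ P (R.src d))
      (fun e : {e // e ∈ (R.nonwhiteDual c).edgeSet} => ∃ d, R.edge d = e.1 ∧ P (R.src d))) (by
    intro p q hpq
    rw [hT, MultiGraph.subdivideDelete_adj_iff] at hpq
    obtain ⟨⟨x, hx⟩, ⟨e, he⟩, hinc, hpq⟩ := hpq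
    obtain ⟨d₁, rfl, rfl, h4, h5⟩ := (nonwhiteDual_inc_iff _ _).1 hinc
    have hb := (hblue _).2 hx
    rcases hpq with ⟨rfl, rfl⟩ | ⟨rfl, rfl⟩
    · rintro ⟨d₂, h6, h7⟩
      have h6' : R.left d₂ = R.left d₁ := h6
      exact ⟨d₁, rfl, (hface d₁ d₂ hb h6'.symm).2 h7⟩
    · rintro ⟨d₂, h6, h7⟩
      refine ⟨d₁, rfl, ?_⟩
      rcases (R.edge_eq_iff _ _).1 h6 with rfl | rfl
      · exact h7
      · exact (hedge _ hb).2 h7)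
    (ht.connected.preconnected (Sum.inl ⟨_, (hblue _).1 hd⟩) (Sum.inl ⟨_, (hblue _).1 hd'⟩))
    ⟨d, rfl, hu⟩
  have h1' : R.left d'' = R.left d' := h1
  exact (hface d' d'' hd' h1'.symm).2 h2

theorem IsRecoloring.isTRVB_iff [Finite D] (hp : R.IsConnectedPlane) (h3 : R.IsCubic)
    {c a : R.Face → FaceColor} (hc : R.IsProperFaceColoring c) (ha : IsRecoloring c a) :
    MultiGraph.IsTRVB (R.nonwhiteDual c) {f | c f = .yellow}
      {f | c f = .yellow ∧ a f = .white} ↔ R.IsConnectedRecoloring c a := by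
  constructor
  · rintro ⟨-, -, ht⟩
    have := hp.nonempty
    obtain ⟨d, hd, -⟩ := exists_isWhiteBlue h3 hc (R.src (Classical.arbitrary D))
    refine ha.isConnectedRecoloring h3 hc ((ha.isBoundary_iff _).2 rfl)
      (ha.connectedBy_of_isTree h3 hc ht) ?_ ?_
    · rcases hd with hd | hd
      · exact ⟨R.left d, by rw [ha.1 _ (by simp [hd.1]), hd.1]⟩
      · exact ⟨R.right d, by rw [ha.1 _ (by simp [hd.2]), hd.2]⟩
    · rcases hd with hd | hd
      · exact ⟨R.right d, by rw [ha.1 _ (by simp [hd.2]), hd.2]⟩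
      · exact ⟨R.left d, by rw [ha.1 _ (by simp [hd.1]), hd.1]⟩
  · intro h
    refine ⟨fun f hf => ⟨?_, hf.1⟩, ?_, h.subdivideDelete_connected hc,
      h.subdivideDelete_isAcyclic hp h3 hc⟩
    · have : c f ≠ .white := by rw [hf.1]; simp
      exact this
    · rintro e x ⟨⟨d, -, h1, h2⟩, -⟩
      exact absurd (congrArg c (h1.trans h2.symm)) (hc d)

/-- A connected recoloring corresponds to the set of the yellow faces which it makes white. -/
noncomputable def trvbEquiv [Finite D] (hp : R.IsConnectedPlane) (h3 : R.IsCubic)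
    {c : R.Face → FaceColor} (hc : R.IsProperFaceColoring c) :
    {a : R.Face → FaceColor // R.IsConnectedRecoloring c a} ≃
      {S : Set R.Face // MultiGraph.IsTRVB (R.nonwhiteDual c) {f | c f = .yellow} S} :=
  Equiv.ofBijective (fun a => ⟨{f | c f = .yellow ∧ a.1 f = .white},
    (a.2.isRecoloring.isTRVB_iff hp h3 hc).2 a.2⟩) (by
  classical
  constructor
  · rintro ⟨a, ha⟩ ⟨b, hb⟩ hab
    have hab' : {f | c f = .yellow ∧ a f = .white} = {f | c f = .yellow ∧ b f = .white} :=
      congrArg Subtype.val hab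
    refine Subtype.ext (funext fun f => ?_)
    have h1 := ha.isRecoloring.eq_blue_iff f
    rw [hab', ← hb.isRecoloring.eq_blue_iff f] at h1
    show a f = b f
    rcases ha.isRecoloring.white_or_blue f with h | h
    · rcases hb.isRecoloring.white_or_blue f with h' | h'
      · rw [h, h']
      · rw [h1.2 h', h']
    · rw [h, h1.1 h]
  · rintro ⟨S, hS⟩
    let a : R.Face → FaceColor := fun f =>
      if c f = .yellow then (if f ∈ S then .white else .blue) else c f
    have ha : IsRecoloring c a := by
      refine ⟨fun f hf => if_neg hf, fun f => ?_⟩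
      simp only [a]
      split_ifs <;> simp_all
    have haS : {f | c f = .yellow ∧ a f = .white} = S := by
      ext f
      refine ⟨fun hf => ?_, fun hf => ?_⟩
      · by_contra h
        have := hf.2
        simp [a, hf.1, h] at this
      · have h1 : c f = .yellow := (hS.1 hf).2
        exact ⟨h1, by simp [a, h1, hf]⟩
    exact ⟨⟨a, (ha.isTRVB_iff hp h3 hc).1 (haS ▸ hS)⟩, Subtype.ext haS⟩)

theorem mem_trvbEquiv [Finite D] (hp : R.IsConnectedPlane) (h3 : R.IsCubic)
    {c : R.Face → FaceColor} (hc : R.IsProperFaceColoring c)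
    (a : {a : R.Face → FaceColor // R.IsConnectedRecoloring c a}) (f : R.Face) :
    f ∈ (trvbEquiv hp h3 hc a).1 ↔ c f = .yellow ∧ a.1 f = .white := Iff.rfl

end RotationSystem

/-! ### Cyclic sequences -/

namespace Cycle

variable {α β γ : Type*}

theorem Nodup.map' {s : Cycle α} {f : α → β} (hf : Function.Injective f) (h : s.Nodup) :
    (s.map f).Nodup := by
  induction s using Quotient.inductionOn' with
  | h l => exact List.Nodup.map hf h

theorem inj_of_nodup_map {s : Cycle α} {f : α → β} (h : (s.map f).Nodup) {x y : α} (hx : x ∈ s)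
    (hy : y ∈ s) (hxy : f x = f y) : x = y := by
  induction s using Quotient.inductionOn' with
  | h l => exact List.inj_on_of_nodup_map h hx hy hxy

theorem map_map' (s : Cycle α) (f : α → β) (g : β → γ) : (s.map f).map g = s.map (g ∘ f) := by
  induction s using Quotient.inductionOn' with
  | h l => exact congrArg _ (List.map_map ..)

theorem map_id' (s : Cycle α) : s.map id = s := by
  induction s using Quotient.inductionOn' with
  | h l => exact congrArg _ (List.map_id l)

theorem map_reverse' (s : Cycle α) (f : α → β) : s.reverse.map f = (s.map f).reverse := by
  induction s using Quotient.inductionOn' with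
  | h l => exact congrArg _ (List.map_reverse ..)

theorem nodup_of_nodup_map {s : Cycle α} {f : α → β} (h : (s.map f).Nodup) : s.Nodup := by
  induction s using Quotient.inductionOn' with
  | h l => exact List.Nodup.of_map f h

theorem exists_eq_cons_of_mem {s : Cycle α} {x : α} (h : x ∈ s) :
    ∃ l : List α, s = ((x :: l : List α) : Cycle α) := by
  induction s using Quotient.inductionOn' with
  | h l =>
    obtain ⟨u, v, rfl⟩ := List.append_of_mem (show x ∈ l from h)
    exact ⟨v ++ u, coe_eq_coe.2 (by simpa using (List.isRotated_append (l := u) (l' := x :: v)))⟩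

theorem chain_reverse {r : α → α → Prop} {s : Cycle α} :
    s.reverse.Chain r ↔ s.Chain fun x y => r y x := by
  induction s using Quotient.inductionOn' with
  | h l =>
    cases l with
    | nil => exact Iff.rfl
    | cons a l =>
      have h : (((a :: l : List α) : Cycle α)).reverse = ((a :: l.reverse : List α) : Cycle α) := by
        rw [reverse_coe, List.reverse_cons, coe_cons_eq_coe_append]
      change ((a :: l : List α) : Cycle α).reverse.Chain r ↔ ((a :: l : List α) : Cycle α).Chain _
      rw [h, chain_coe_cons, chain_coe_cons]
      have h2 : a :: (l.reverse ++ [a]) = (a :: (l ++ [a])).reverse := by simp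
      rw [h2, List.isChain_reverse]

/-- Reading `g` one place later gives `f`, so the two images are rotations of each other. -/
theorem map_eq_map_of_chain {f g : α → β} {s : Cycle α} (h : s.Chain fun x y => g y = f x) :
    s.map g = s.map f := by
  have key : ∀ (l : List α) (a z : α), List.IsChain (fun x y => g y = f x) (a :: (l ++ [z])) →
      (l ++ [z]).map g = (a :: l).map f := by
    intro l
    induction l with
    | nil => intro a z h; simpa using h
    | cons b l ih =>
      intro a z h
      rw [List.cons_append, List.isChain_cons_cons] at h
      rw [List.cons_append, List.map_cons, List.map_cons, ih b z h.2, h.1]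
  induction s using Quotient.inductionOn' with
  | h l =>
    cases l with
    | nil => rfl
    | cons a l =>
      change ((a :: l : List α) : Cycle α).map g = ((a :: l : List α) : Cycle α).map f
      rw [coe_cons_eq_coe_append, map_coe, key l a a h, ← map_coe, coe_cons_eq_coe_append]

theorem _root_.List.IsChain.eq_iterate {f : α → α} {a : α} {l : List α}
    (h : List.IsChain (fun x y => y = f x) (a :: l)) : a :: l = List.iterate f a (l.length + 1) := by
  induction l generalizing a with
  | nil => rfl
  | cons b l ih =>
    rw [List.isChain_cons_cons] at h
    rw [List.length_cons, List.iterate, ← h.1, ← ih h.2]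

/-- From a common element both sequences list the iterates of `f` until the return to `a`; if one
were shorter, its return would be a repetition in the other. -/
theorem eq_of_chain {f : α → α} {s t : Cycle α} (hs : s.Nodup) (ht : t.Nodup)
    (hs' : s.Chain fun x y => y = f x) (ht' : t.Chain fun x y => y = f x) {a : α} (has : a ∈ s)
    (hat : a ∈ t) : s = t := by
  obtain ⟨l, rfl⟩ := exists_eq_cons_of_mem has
  obtain ⟨m, rfl⟩ := exists_eq_cons_of_mem hat
  rw [chain_coe_cons] at hs' ht'
  rw [nodup_coe_iff] at hs ht
  have key : ∀ l : List α, List.IsChain (fun x y => y = f x) (a :: (l ++ [a])) →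
      a :: l = List.iterate f a (l.length + 1) ∧ f^[l.length + 1] a = a := by
    intro l h
    constructor
    · have h1 : List.IsChain (fun x y => y = f x) ((a :: l) ++ [a]) := h
      exact (List.isChain_append.1 h1).1.eq_iterate
    · have h1 := h.eq_iterate
      have h2 : (a :: (l ++ [a]))[l.length + 1]? = some a := by simp
      rw [h1, List.getElem?_eq_getElem (by simp), List.getElem_iterate] at h2
      exact Option.some.inj h2
  obtain ⟨h1, h2⟩ := key l hs'
  obtain ⟨h4, h5⟩ := key m ht'
  have hlt : ∀ l m : List α, a :: m = List.iterate f a (m.length + 1) → (a :: m).Nodup →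
      f^[l.length + 1] a = a → ¬l.length < m.length := by
    intro l m h1 h2 h4 h5
    rw [h1] at h2
    have := (List.Nodup.getElem_inj_iff h2 (i := 0) (j := l.length + 1) (hi := by simp)
      (hj := by simpa using h5)).1 (by simp [List.getElem_iterate, ← Function.iterate_succ_apply, h4])
    omega
  have : l.length = m.length :=
    le_antisymm (not_lt.1 (hlt m l h1 hs h5)) (not_lt.1 (hlt l m h4 ht h2))
  rw [h1, h4, this]

end Cycle

namespace RotationSystem

variable {α β : Type*}

theorem followedBy_mem_left {t : Cycle α} {x y : α} (h : FollowedBy t x y) : x ∈ t := by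
  obtain ⟨l, rfl, -⟩ := h
  simp

theorem followedBy_mem_right {t : Cycle α} {x y : α} (h : FollowedBy t x y) : y ∈ t := by
  obtain ⟨l, rfl, h⟩ := h
  have := List.mem_of_mem_head? (Option.mem_def.2 h)
  rw [Cycle.mem_coe_iff]
  simpa [or_comm] using this

theorem exists_followedBy_of_mem {t : Cycle α} {x : α} (h : x ∈ t) : ∃ y, FollowedBy t x y := by
  obtain ⟨l, rfl⟩ := Cycle.exists_eq_cons_of_mem h
  cases l with
  | nil => exact ⟨x, [], rfl, rfl⟩
  | cons y l => exact ⟨y, y :: l, rfl, rfl⟩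

theorem exists_followedBy_of_mem' {t : Cycle α} {y : α} (h : y ∈ t) : ∃ x, FollowedBy t x y := by
  obtain ⟨l, rfl⟩ := Cycle.exists_eq_cons_of_mem h
  rcases l.eq_nil_or_concat with rfl | ⟨l, x, rfl⟩
  · exact ⟨y, [], rfl, rfl⟩
  · refine ⟨x, y :: l, ?_, rfl⟩
    have e : ((y :: l.concat x : List α) : Cycle α) = ((y :: l ++ [x] : List α) : Cycle α) := by
      simp
    exact e.trans (Cycle.coe_cons_eq_coe_append (y :: l) x).symm

theorem FollowedBy.map {t : Cycle α} {x y : α} (f : α → β) (h : FollowedBy t x y) :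
    FollowedBy (t.map f) (f x) (f y) := by
  obtain ⟨l, rfl, h⟩ := h
  refine ⟨l.map f, rfl, ?_⟩
  cases l <;> simp_all

theorem FollowedBy.unique {t : Cycle α} (ht : t.Nodup) {x y y' : α} (h : FollowedBy t x y)
    (h' : FollowedBy t x y') : y = y' := by
  classical
  have key : ∀ y, FollowedBy t x y → ∀ hx, y = t.next ht x hx := by
    rintro y ⟨l, rfl, hy⟩ hx
    cases l with
    | nil =>
      have h1 : x = y := by simpa using hy
      rw [← h1]
      exact (List.next_singleton x x (by simp)).symm
    | cons z l =>
      have h1 : z = y := by simpa using hy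
      rw [← h1]
      exact (List.next_cons_cons_eq l x z hx).symm
  rw [key y h (followedBy_mem_left h), key y' h' (followedBy_mem_left h)]

theorem chain_iff_followedBy {r : α → α → Prop} {t : Cycle α} :
    t.Chain r ↔ ∀ x y, FollowedBy t x y → r x y := by
  constructor
  · rintro h x y ⟨l, rfl, hl⟩
    rw [Cycle.chain_coe_cons] at h
    cases hl' : l ++ [x] with
    | nil => simp at hl'
    | cons z m =>
      rw [hl'] at h hl
      have h1 : z = y := by simpa using hl
      rw [← h1]
      exact (List.isChain_cons_cons.1 h).1
  · intro h
    refine Cycle.Chain.imp h ?_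
    -- `u` holds the entries already passed, and `b` is the first entry of the whole list, which
    -- follows the last one cyclically.
    have key : ∀ (v u : List α) (x b : α), ((u ++ x :: v : List α) : Cycle α) = t →
        (u ++ [x]).head? = some b → List.IsChain (FollowedBy t) (x :: (v ++ [b])) := by
      intro v
      induction v with
      | nil =>
        intro u x b hu hb
        refine List.isChain_pair.2 ⟨u, ?_, hb⟩
        rw [← hu, Cycle.coe_cons_eq_coe_append]
      | cons y v ih =>
        intro u x b hu hb
        rw [List.cons_append, List.isChain_cons_cons]
        refine ⟨⟨y :: (v ++ u), ?_, rfl⟩, ih (u ++ [x]) y b (by simpa using hu) ?_⟩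
        · rw [← hu]
          exact Cycle.coe_eq_coe.2
            (by simpa using (List.isRotated_append (l := u) (l' := x :: y :: v)))
        · cases u <;> simp_all
    induction t using Quotient.inductionOn' with
    | h l =>
      cases l with
      | nil => trivial
      | cons a l => exact key l [] a a rfl rfl

end RotationSystem

/-! ### Kiki Euler tours and corner sets -/

namespace RotationSystem

variable {D : Type*} {R : RotationSystem D}

/-- A set of corners, each given by the first of its two edge ends. At every vertex the corners
are alternately in and out of `B`, and joining the edge ends at the corners in `B` connects all
edges to a single closed curve. -/
def IsTourCorners (R : RotationSystem D) (B : Set D) : Prop :=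
  (∀ d, R.next d ∈ B ↔ d ∉ B) ∧ ∀ P : D → Prop, (∀ d, P d → P (R.flip d)) →
    (∀ d ∈ B, (P d ↔ P (R.next d))) → ∀ x y, P x → P y

/-- The corners at which a sided tour turns. -/
def sidedCorners (R : RotationSystem D) (t : Cycle (D × Bool)) : Set D :=
  {d | (d, true) ∈ t ∨ (R.next d, false) ∈ t}

/-- The corners at which a tour turns. -/
def corners (R : RotationSystem D) (t : Cycle D) : Set D :=
  {d | FollowedBy t (R.flip d) (R.next d) ∨ FollowedBy t (R.flip (R.next d)) d}

theorem next_next_symm (R : RotationSystem D) (d : D) : R.next (R.next⁻¹ d) = d := by simp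

theorem next_symm_next (R : RotationSystem D) (d : D) : R.next⁻¹ (R.next d) = d := by simp

theorem exit_true (x : D) : R.exit (x, true) = R.next x := rfl

theorem exit_false (x : D) : R.exit (x, false) = R.next⁻¹ x := rfl

theorem exit_exit (p : D × Bool) : R.exit (R.exit p, !p.2) = p.1 := by
  obtain ⟨x, b⟩ := p
  cases b
  · rw [exit_false]
    exact R.next_next_symm x
  · rw [exit_true]
    exact R.next_symm_next x

/-- The reverse of a sided tour. -/
def sidedReverse (R : RotationSystem D) (t : Cycle (D × Bool)) : Cycle (D × Bool) :=
  t.reverse.map fun p => (R.exit p, !p.2)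

theorem isSidedKikiEulerTour_iff (t : Cycle (D × Bool)) :
    R.IsSidedKikiEulerTour t ↔ (t.map R.exit).Nodup ∧
      (∀ d, d ∈ t.map R.exit ↔ R.flip d ∉ t.map R.exit) ∧
      t.Chain fun p q => q.1 = R.flip (R.exit p) := by
  refine ⟨fun h => ⟨h.1.1, h.1.2.1, h.2⟩, fun h => ⟨⟨h.1, h.2.1, ?_⟩, h.2.2⟩⟩
  rw [Cycle.chain_map]
  refine h.2.2.imp ?_
  rintro p ⟨x, b⟩ (rfl : x = _)
  cases b
  · exact R.src_next_symm _
  · exact R.src_next _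

theorem IsSidedKikiEulerTour.map_fst {t : Cycle (D × Bool)} (h : R.IsSidedKikiEulerTour t) :
    t.map Prod.fst = (t.map R.exit).map R.flip := by
  rw [Cycle.map_map']
  exact Cycle.map_eq_map_of_chain h.2

theorem IsSidedKikiEulerTour.mem_map_fst_iff {t : Cycle (D × Bool)}
    (h : R.IsSidedKikiEulerTour t) (d : D) : d ∈ t.map Prod.fst ↔ d ∉ t.map R.exit := by
  rw [h.map_fst, h.1.2.1 d, not_not, Cycle.mem_map]
  constructor
  · rintro ⟨x, hx, rfl⟩
    rwa [R.flip_flip]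
  · exact fun hd => ⟨_, hd, R.flip_flip d⟩

theorem IsSidedKikiEulerTour.nodup_map_fst {t : Cycle (D × Bool)}
    (h : R.IsSidedKikiEulerTour t) : (t.map Prod.fst).Nodup := by
  rw [h.map_fst]
  exact h.1.1.map' R.flip.injective

theorem map_exit_sidedReverse (t : Cycle (D × Bool)) :
    (R.sidedReverse t).map R.exit = (t.map Prod.fst).reverse := by
  rw [sidedReverse, Cycle.map_map', ← Cycle.map_reverse']
  congr 1
  exact funext exit_exit

theorem IsSidedKikiEulerTour.sidedReverse {t : Cycle (D × Bool)}
    (h : R.IsSidedKikiEulerTour t) : R.IsSidedKikiEulerTour (R.sidedReverse t) := by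
  rw [isSidedKikiEulerTour_iff, map_exit_sidedReverse]
  refine ⟨Cycle.nodup_reverse_iff.2 h.nodup_map_fst, fun d => ?_, ?_⟩
  · rw [Cycle.mem_reverse_iff, Cycle.mem_reverse_iff, h.mem_map_fst_iff, h.mem_map_fst_iff,
      h.1.2.1 d, not_not]
  · rw [RotationSystem.sidedReverse, Cycle.chain_map, Cycle.chain_reverse]
    refine h.2.imp fun p q hpq => ?_
    rw [exit_exit, hpq, R.flip_flip]

theorem sidedCorners_sidedReverse (t : Cycle (D × Bool)) :
    R.sidedCorners (R.sidedReverse t) = R.sidedCorners t := by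
  ext d
  have h1 : (d, true) ∈ R.sidedReverse t ↔ (R.next d, false) ∈ t := by
    rw [sidedReverse, Cycle.mem_map]
    constructor
    · rintro ⟨⟨x, b⟩, hp, h⟩
      obtain ⟨h1, h2⟩ : R.exit (x, b) = d ∧ (!b) = true := Prod.ext_iff.1 h
      cases b
      · have : R.next d = x := by
          rw [← h1, exit_false]
          exact R.next_next_symm x
        rwa [this, ← Cycle.mem_reverse_iff]
      · simp at h2
    · exact fun h => ⟨_, Cycle.mem_reverse_iff.2 h, by simp [exit_false]⟩
  have h2 : (R.next d, false) ∈ R.sidedReverse t ↔ (d, true) ∈ t := by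
    rw [sidedReverse, Cycle.mem_map]
    constructor
    · rintro ⟨⟨x, b⟩, hp, h⟩
      obtain ⟨h1, h2⟩ := Prod.ext_iff.1 h
      cases b
      · simp at h2
      · have : x = d := R.next.injective h1
        rwa [this, Cycle.mem_reverse_iff] at hp
    · exact fun h => ⟨_, Cycle.mem_reverse_iff.2 h, by simp [exit_true]⟩
  change _ ∨ _ ↔ _ ∨ _
  rw [h1, h2, or_comm]

/-- Each edge end takes part in exactly one turn, as its entrance or its exit. Hence exactly one of
the two corners next to it is turned at. -/
theorem IsSidedKikiEulerTour.next_mem_sidedCorners_iff {t : Cycle (D × Bool)}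
    (h : R.IsSidedKikiEulerTour t) (d : D) :
    R.next d ∈ R.sidedCorners t ↔ d ∉ R.sidedCorners t := by
  have hf : ∀ x b, (x, b) ∈ t → x ∈ t.map Prod.fst := fun x b hx =>
    Cycle.mem_map.2 ⟨_, hx, rfl⟩
  have he : ∀ x b, (x, b) ∈ t → R.exit (x, b) ∈ t.map R.exit := fun x b hx =>
    Cycle.mem_map.2 ⟨_, hx, rfl⟩
  have hfe := h.mem_map_fst_iff (R.next d)
  have e1 : R.exit (R.next (R.next d), false) = R.next d := by simp [exit_false]
  have e2 : R.exit (d, true) = R.next d := rfl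
  change _ ∨ _ ↔ ¬(_ ∨ _)
  by_cases hd : R.next d ∈ t.map R.exit
  · have n1 : ∀ b, (R.next d, b) ∉ t := fun b hb => hfe.1 (hf _ b hb) hd
    have n2 : ¬((R.next (R.next d), false) ∈ t ∧ (d, true) ∈ t) := fun h1 => by
      have := Cycle.inj_of_nodup_map h.1.1 h1.1 h1.2 (e1.trans e2.symm)
      simp at this
    have n3 : (R.next (R.next d), false) ∈ t ∨ (d, true) ∈ t := by
      obtain ⟨⟨x, b⟩, hx, hxd⟩ := Cycle.mem_map.1 hd
      cases b
      · left
        have : R.next (R.next d) = x := by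
          rw [← hxd, exit_false]
          exact R.next_next_symm x
        rwa [this]
      · right
        have : x = d := R.next.injective hxd
        rwa [← this]
    have a1 := n1 true
    have a2 := n1 false
    tauto
  · have n1 : (R.next (R.next d), false) ∉ t := fun h1 => hd (e1 ▸ he _ _ h1)
    have n2 : (d, true) ∉ t := fun h1 => hd (e2 ▸ he _ _ h1)
    have n3 : ¬((R.next d, true) ∈ t ∧ (R.next d, false) ∈ t) := fun h1 => by
      have := Cycle.inj_of_nodup_map h.nodup_map_fst h1.1 h1.2 rfl
      simp at this
    have n4 : (R.next d, true) ∈ t ∨ (R.next d, false) ∈ t := by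
      obtain ⟨⟨x, b⟩, hx, rfl : x = _⟩ := Cycle.mem_map.1 (hfe.2 hd)
      cases b
      · exact Or.inr hx
      · exact Or.inl hx
    tauto

theorem IsSidedKikiEulerTour.snd_eq {t : Cycle (D × Bool)} (h : R.IsSidedKikiEulerTour t)
    {x : D} {b : Bool} (hx : (x, b) ∈ t) : b = true ↔ x ∈ R.sidedCorners t := by
  cases b
  · have h1 := h.next_mem_sidedCorners_iff (R.next⁻¹ x)
    have e : R.next (R.next⁻¹ x) = x := R.next_next_symm x
    rw [e] at h1
    have h2 : R.next⁻¹ x ∈ R.sidedCorners t := Or.inr (by rwa [e])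
    simp only [Bool.false_eq_true, false_iff]
    tauto
  · exact iff_of_true rfl (Or.inl hx)

/-- A predicate respecting flips and the corners turned at is constant along the tour, and the tour
meets every edge end. -/
theorem IsSidedKikiEulerTour.isTourCorners {t : Cycle (D × Bool)}
    (h : R.IsSidedKikiEulerTour t) : R.IsTourCorners (R.sidedCorners t) := by
  refine ⟨h.next_mem_sidedCorners_iff, fun P hP hB => ?_⟩
  have hP' : ∀ d, P (R.flip d) ↔ P d := fun d =>
    ⟨fun h => by simpa only [R.flip_flip] using hP _ h, hP d⟩
  have hexit : ∀ p ∈ t, (P (R.exit p) ↔ P p.1) := by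
    rintro ⟨x, b⟩ hp
    cases b
    · have e : R.next (R.next⁻¹ x) = x := R.next_next_symm x
      have := hB (R.next⁻¹ x) (Or.inr (by rwa [e]))
      rwa [e] at this
    · exact (hB x (Or.inl hp)).symm
  have hchain : t.Chain fun p q => P p.1 ↔ P q.1 := by
    rw [chain_iff_followedBy]
    intro p q hpq
    rw [chain_iff_followedBy.1 h.2 p q hpq, hP', hexit p (followedBy_mem_left hpq)]
  have : IsTrans (D × Bool) fun p q => P p.1 ↔ P q.1 := ⟨fun _ _ _ h1 h2 => h1.trans h2⟩
  rw [Cycle.chain_iff_pairwise] at hchain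
  have hall : ∀ x, ∃ p ∈ t, (P x ↔ P p.1) := by
    intro x
    by_cases hx : x ∈ t.map R.exit
    · obtain ⟨p, hp, rfl⟩ := Cycle.mem_map.1 hx
      exact ⟨p, hp, hexit p hp⟩
    · obtain ⟨p, hp, rfl⟩ := Cycle.mem_map.1 ((h.mem_map_fst_iff x).2 hx)
      exact ⟨p, hp, Iff.rfl⟩
  intro x y hx
  obtain ⟨p, hp, hxp⟩ := hall x
  obtain ⟨q, hq, hyq⟩ := hall y
  exact hyq.2 ((hchain p hp q hq).1 (hxp.1 hx))

theorem IsSidedKikiEulerTour.chain_eq {t : Cycle (D × Bool)} (h : R.IsSidedKikiEulerTour t)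
    {f : D × Bool → D × Bool} (hf : ∀ p, (f p).1 = R.flip (R.exit p))
    (hf' : ∀ p, (f p).2 = true ↔ (f p).1 ∈ R.sidedCorners t) : t.Chain fun p q => q = f p := by
  rw [chain_iff_followedBy]
  rintro p ⟨x, b⟩ hpq
  have h1 := chain_iff_followedBy.1 h.2 p _ hpq
  have h2 := h.snd_eq (followedBy_mem_right hpq)
  refine Prod.ext (h1.trans (hf p).symm) ?_
  rw [Bool.eq_iff_iff, hf', h2, hf, ← h1]

/-- The corners determine the successor of each turn, so tours that share an entrance coincide. An
end that is not an entrance of `t` is one of its reverse. -/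
theorem IsSidedKikiEulerTour.eq_of_sidedCorners_eq [Nonempty D] {s t : Cycle (D × Bool)}
    (hs : R.IsSidedKikiEulerTour s) (ht : R.IsSidedKikiEulerTour t)
    (h : R.sidedCorners s = R.sidedCorners t) : s = t ∨ s = R.sidedReverse t := by
  classical
  let f : D × Bool → D × Bool := fun p =>
    (R.flip (R.exit p), decide (R.flip (R.exit p) ∈ R.sidedCorners s))
  have key : ∀ t, R.IsSidedKikiEulerTour t → R.sidedCorners s = R.sidedCorners t →
      ∀ p ∈ s, p.1 ∈ t.map Prod.fst → s = t := by
    rintro t ht h ⟨x, b⟩ hp hpt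
    obtain ⟨⟨y, b'⟩, hq, rfl : y = x⟩ := Cycle.mem_map.1 hpt
    have : b = b' := by
      rw [Bool.eq_iff_iff, hs.snd_eq hp, ht.snd_eq hq, h]
    subst this
    exact Cycle.eq_of_chain (f := f) (Cycle.nodup_of_nodup_map hs.1.1)
      (Cycle.nodup_of_nodup_map ht.1.1) (hs.chain_eq (fun _ => rfl) (by simp [f]))
      (ht.chain_eq (fun _ => rfl) (by simp [f, h])) hp hq
  obtain ⟨p, hp⟩ : ∃ p, p ∈ s := by
    obtain ⟨d⟩ := ‹Nonempty D›
    by_cases hd : d ∈ s.map R.exit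
    · obtain ⟨p, hp, -⟩ := Cycle.mem_map.1 hd
      exact ⟨p, hp⟩
    · obtain ⟨p, hp, -⟩ := Cycle.mem_map.1 ((hs.mem_map_fst_iff d).2 hd)
      exact ⟨p, hp⟩
  by_cases hpt : p.1 ∈ t.map Prod.fst
  · exact Or.inl (key t ht h p hp hpt)
  · refine Or.inr (key _ ht.sidedReverse (h.trans (sidedCorners_sidedReverse t).symm) p hp ?_)
    rw [ht.sidedReverse.mem_map_fst_iff, map_exit_sidedReverse, Cycle.mem_reverse_iff]
    exact hpt

/-- The corners in `B` pair up the edge ends, and alternating this pairing with `flip` traces closed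
curves. `τ` is a consistent direction for them, and connectedness leaves only one curve. -/
theorem IsTourCorners.exists_sidedCorners_eq [Finite D] [Nonempty D] {B : Set D}
    (hB : R.IsTourCorners B) {τ : D → Prop} (hflip : ∀ d, τ (R.flip d) ↔ ¬τ d)
    (hnext : ∀ d, τ (R.next d) ↔ ¬τ d) :
    ∃ t, R.IsSidedKikiEulerTour t ∧ R.sidedCorners t = B := by
  classical
  let g : D → D × Bool := fun x => (x, decide (x ∈ B))
  -- Because corners alternate, crossing the corner in `B` at an end is an involution.
  let m : D → D := fun x => R.exit (g x)
  have hm1 : ∀ x, x ∈ B → m x = R.next x := fun x hx => by simp [m, g, hx, exit_true]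
  have hm2 : ∀ x, x ∉ B → m x = R.next⁻¹ x := fun x hx => by simp [m, g, hx, exit_false]
  have hn : ∀ x, R.next (R.next⁻¹ x) = x := R.next_next_symm
  have hn' : ∀ x, R.next⁻¹ (R.next x) = x := R.next_symm_next
  have hmm : ∀ x, m (m x) = x := by
    intro x
    by_cases hx : x ∈ B
    · rw [hm1 x hx, hm2 _ fun h => (hB.1 x).1 h hx, hn']
    · have : R.next⁻¹ x ∈ B := by
        by_contra h
        have := (hB.1 _).2 h
        rw [hn] at this
        exact hx this
      rw [hm2 x hx, hm1 _ this, hn]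
  have hminj : Function.Injective m := Function.LeftInverse.injective hmm
  have hmτ : ∀ x, τ (m x) ↔ ¬τ x := by
    intro x
    by_cases hx : x ∈ B
    · rw [hm1 x hx, hnext]
    · have := hnext (R.next⁻¹ x)
      rw [hn] at this
      rw [hm2 x hx]
      tauto
  let F : D → D := fun x => R.flip (m x)
  have hF : Function.Injective F := R.flip.injective.comp hminj
  obtain ⟨x₀⟩ := ‹Nonempty D›
  have hx₀ : x₀ ∈ Function.periodicPts F := hF.mem_periodicPts x₀
  let O := Function.periodicOrbit F x₀
  -- Both `m` and `flip` reverse `τ`, so their composite preserves it. Entrances and exits of the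
  -- orbit then differ in `τ`, so no edge is traversed twice.
  have hτ : ∀ x ∈ O, (τ x ↔ τ x₀) := by
    intro x hx
    obtain ⟨n, rfl⟩ := (Function.mem_periodicOrbit_iff hx₀).1 hx
    induction n with
    | zero => rfl
    | succ n ih =>
      rw [Function.iterate_succ_apply', hflip, hmτ, not_not]
      exact ih (Function.iterate_mem_periodicOrbit hx₀ n)
  have hE : ∀ d, d ∈ (O.map g).map R.exit ↔ ∃ x ∈ O, m x = d := by
    intro d
    rw [Cycle.map_map', Cycle.mem_map]
    rfl
  have hchain : (O.map g).Chain fun p q => q.1 = R.flip (R.exit p) := by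
    rw [Cycle.chain_map, Function.periodicOrbit_chain' _ hx₀]
    intro n
    exact Function.iterate_succ_apply' F n x₀
  have hOE : ∀ d, d ∈ O ↔ R.flip d ∈ (O.map g).map R.exit := by
    intro d
    have h1 := Cycle.map_eq_map_of_chain hchain
    rw [Cycle.map_map'] at h1
    have h2 : O.map (Prod.fst ∘ g) = O := Cycle.map_id' O
    rw [h2] at h1
    have h4 : d ∈ O ↔ d ∈ (O.map g).map fun p => R.flip (R.exit p) := by
      conv_lhs => rw [h1]
    rw [h4, Cycle.mem_map, Cycle.mem_map]
    constructor
    · rintro ⟨p, hp, rfl⟩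
      exact ⟨p, hp, by rw [R.flip_flip]⟩
    · rintro ⟨p, hp, h⟩
      exact ⟨p, hp, by rw [h, R.flip_flip]⟩
  have hdisj : ∀ d ∈ O, d ∉ (O.map g).map R.exit := by
    intro d hd hd'
    obtain ⟨x, hx, rfl⟩ := (hE d).1 hd'
    have h1 := hτ _ hx
    have h2 := hτ _ hd
    rw [hmτ] at h2
    tauto
  have hmP : ∀ d, (d ∈ O ∨ d ∈ (O.map g).map R.exit) →
      (m d ∈ O ∨ m d ∈ (O.map g).map R.exit) := by
    rintro d (hd | hd)
    · exact Or.inr ((hE _).2 ⟨d, hd, rfl⟩)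
    · obtain ⟨x, hx, rfl⟩ := (hE d).1 hd
      rw [hmm]
      exact Or.inl hx
  have hcover : ∀ d, d ∈ O ∨ d ∈ (O.map g).map R.exit := by
    intro d
    refine hB.2 (fun d => d ∈ O ∨ d ∈ (O.map g).map R.exit) ?_ ?_ x₀ d
      (Or.inl (Function.self_mem_periodicOrbit hx₀))
    · rintro d (hd | hd)
      · exact Or.inr ((hOE d).1 hd)
      · exact Or.inl ((hOE _).2 (by rwa [R.flip_flip]))
    · intro d hd
      rw [← hm1 d hd]
      exact ⟨hmP d, fun h => by simpa only [hmm] using hmP _ h⟩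
  refine ⟨O.map g, (isSidedKikiEulerTour_iff _).2 ⟨?_, fun d => ?_, hchain⟩, ?_⟩
  · rw [Cycle.map_map']
    exact Function.nodup_periodicOrbit.map' hminj
  · rw [← hOE]
    exact ⟨fun h h' => hdisj d h' h, fun h => (hcover d).resolve_left h⟩
  · have hmem : ∀ x b, (x, b) ∈ O.map g ↔ x ∈ O ∧ (b = true ↔ x ∈ B) := by
      intro x b
      rw [Cycle.mem_map]
      constructor
      · rintro ⟨y, hy, h⟩
        obtain ⟨rfl, rfl⟩ := Prod.ext_iff.1 h
        exact ⟨hy, by simp [g]⟩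
      · rintro ⟨hx, hb⟩
        exact ⟨x, hx, Prod.ext rfl (by rw [Bool.eq_iff_iff, hb]; simp [g])⟩
    ext d
    change _ ∨ _ ↔ _
    rw [hmem, hmem, hB.1]
    simp only [Bool.false_eq_true, false_iff, not_not, true_iff]
    rw [← or_and_right]
    refine and_iff_right_of_imp fun hd => ?_
    rcases hcover d with h | h
    · exact Or.inl h
    · obtain ⟨x, hx, rfl⟩ := (hE d).1 h
      right
      rw [← hm1 _ hd, hmm]
      exact hx

/-- Sided kiki Euler tours correspond to the sets of the corners at which they turn. -/
noncomputable def sidedKikiEulerTourEquiv [Finite D] [Nonempty D] (R : RotationSystem D)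
    (τ : D → Prop) (hflip : ∀ d, τ (R.flip d) ↔ ¬τ d) (hnext : ∀ d, τ (R.next d) ↔ ¬τ d) :
    R.SidedKikiEulerTour ≃ {B : Set D // R.IsTourCorners B} :=
  Equiv.ofBijective
    (Quot.lift (fun t => ⟨R.sidedCorners t.1, t.2.isTourCorners⟩) (by
      rintro ⟨s, hs⟩ ⟨t, ht⟩ (rfl : t = R.sidedReverse s)
      exact Subtype.ext (sidedCorners_sidedReverse s).symm)) (by
  constructor
  · rintro ⟨s, hs⟩ ⟨t, ht⟩ h
    rcases hs.eq_of_sidedCorners_eq ht (congrArg Subtype.val h) with rfl | rfl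
    · rfl
    · symm
      exact Quot.sound rfl
  · rintro ⟨B, hB⟩
    obtain ⟨t, ht, rfl⟩ := hB.exists_sidedCorners_eq hflip hnext
    exact ⟨Quot.mk _ ⟨t, ht⟩, rfl⟩)

theorem IsSidedKikiEulerTour.isKikiEulerTour {t : Cycle (D × Bool)}
    (h : R.IsSidedKikiEulerTour t) : R.IsKikiEulerTour (t.map R.exit) := by
  refine ⟨h.1, ?_⟩
  rw [Cycle.chain_map]
  refine h.2.imp ?_
  rintro p ⟨x, b⟩ (rfl : x = _)
  cases b
  · exact Or.inr rfl
  · exact Or.inl rfl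

theorem IsKikiEulerTour.exists_sided {s : Cycle D} (h : R.IsKikiEulerTour s) :
    ∃ t, R.IsSidedKikiEulerTour t ∧ t.map R.exit = s := by
  classical
  -- Where both sides are possible, the counterclockwise one is chosen.
  let g : D → D × Bool := fun d => (R.flip d, decide (FollowedBy s d (R.next (R.flip d))))
  have hg : s.Chain fun d d' => id d' = R.exit (g d) := by
    rw [chain_iff_followedBy]
    intro d d' hd
    rcases chain_iff_followedBy.1 h.2 d d' hd with rfl | rfl
    · simp [g, hd, exit_true]
    · by_cases h1 : FollowedBy s d (R.next (R.flip d))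
      · simp only [g, h1, decide_true, exit_true, id]
        exact hd.unique h.1.1 h1
      · simp only [g, h1, decide_false, exit_false, id]
  have hs : (s.map g).map R.exit = s := by
    rw [Cycle.map_map', ← Cycle.map_id' (s.map _)]
    have := Cycle.map_eq_map_of_chain (f := R.exit ∘ g) hg
    rw [Cycle.map_id', ← this, Cycle.map_id']
  refine ⟨s.map g, ⟨by rw [hs]; exact h.1, ?_⟩, hs⟩
  rw [Cycle.chain_map]
  refine hg.imp fun d d' hd => ?_
  rw [← hd]
  rfl

/-- If the two neighbors of every end differ, the dart on which the tour leaves reveals the side. -/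
theorem IsSidedKikiEulerTour.corners_map_exit {t : Cycle (D × Bool)}
    (h : R.IsSidedKikiEulerTour t) (hne : ∀ d, R.next d ≠ R.next⁻¹ d) :
    R.corners (t.map R.exit) = R.sidedCorners t := by
  have key : ∀ x b, FollowedBy (t.map R.exit) (R.flip x) (R.exit (x, b)) ↔ (x, b) ∈ t := by
    intro x b
    constructor
    · intro hx
      obtain ⟨p, hp, hpx⟩ := Cycle.mem_map.1 (followedBy_mem_left hx)
      obtain ⟨⟨y, b'⟩, hq⟩ := exists_followedBy_of_mem hp
      have h1 : y = R.flip (R.exit p) := chain_iff_followedBy.1 h.2 _ _ hq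
      rw [hpx, R.flip_flip] at h1
      subst h1
      have h2 := hq.map R.exit
      rw [hpx] at h2
      have h4 := h2.unique h.1.1 hx
      have h5 : b' = b := by
        cases b <;> cases b'
        · rfl
        · exact absurd h4 (hne y)
        · exact absurd h4.symm (hne y)
        · rfl
      subst h5
      exact followedBy_mem_right hq
    · intro hx
      obtain ⟨p, hp⟩ := exists_followedBy_of_mem' hx
      have h1 : x = R.flip (R.exit p) := chain_iff_followedBy.1 h.2 _ _ hp
      have h2 := hp.map R.exit
      rwa [show R.flip x = R.exit p by rw [h1, R.flip_flip]]
  ext d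
  have e : R.exit (R.next d, false) = d := R.next_symm_next d
  have k1 := key d true
  have k2 := key (R.next d) false
  rw [e] at k2
  exact or_congr k1 k2

/-- Kiki Euler tours correspond to the sets of the corners at which they turn, if there are no
vertices of degree two. -/
noncomputable def kikiEulerTourEquiv [Finite D] [Nonempty D] (R : RotationSystem D)
    (τ : D → Prop) (hflip : ∀ d, τ (R.flip d) ↔ ¬τ d) (hnext : ∀ d, τ (R.next d) ↔ ¬τ d)
    (hne : ∀ d, R.next d ≠ R.next⁻¹ d) :
    R.KikiEulerTour ≃ {B : Set D // R.IsTourCorners B} :=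
  have hrev : ∀ t, R.IsSidedKikiEulerTour t →
      (t.map R.exit).reverse.map R.flip = (R.sidedReverse t).map R.exit := fun t ht => by
    rw [map_exit_sidedReverse, ht.map_fst, Cycle.map_reverse']
  Equiv.ofBijective
    (Quot.lift (fun s => ⟨R.corners s.1, by
      obtain ⟨t, ht, h⟩ := s.2.exists_sided
      rw [← h, ht.corners_map_exit hne]
      exact ht.isTourCorners⟩) (by
      rintro ⟨s, hs⟩ ⟨s', hs'⟩ (rfl : s' = _)
      obtain ⟨t, ht, rfl⟩ := hs.exists_sided
      refine Subtype.ext ?_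
      change R.corners (t.map R.exit) = R.corners ((t.map R.exit).reverse.map R.flip)
      rw [hrev t ht, ht.corners_map_exit hne, ht.sidedReverse.corners_map_exit hne,
        sidedCorners_sidedReverse])) (by
  constructor
  · rintro ⟨s, hs⟩ ⟨s', hs'⟩ h
    obtain ⟨t, ht, rfl⟩ := hs.exists_sided
    obtain ⟨t', ht', rfl⟩ := hs'.exists_sided
    have h' : R.corners (t.map R.exit) = R.corners (t'.map R.exit) := congrArg Subtype.val h
    rw [ht.corners_map_exit hne, ht'.corners_map_exit hne] at h'
    rcases ht.eq_of_sidedCorners_eq ht' h' with rfl | rfl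
    · rfl
    · symm
      exact Quot.sound (hrev t' ht').symm
  · rintro ⟨B, hB⟩
    obtain ⟨t, ht, rfl⟩ := hB.exists_sidedCorners_eq hflip hnext
    exact ⟨Quot.mk _ ⟨t.map R.exit, ht.isKikiEulerTour⟩, Subtype.ext (ht.corners_map_exit hne)⟩)

end RotationSystem

/-! ### Hamiltonian cycles and kiki Euler tours -/

namespace RotationSystem

variable {D : Type*} {R : RotationSystem D}

/-- The corner after `d` in the contraction is the yellow-face edge `next d`; seen from its other
end, this edge is the clockwise neighbor of the next white-blue dart. -/
theorem next_symm_contractYellow_next (h3 : R.IsCubic) {c : R.Face → FaceColor}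
    (hc : R.IsProperFaceColoring c) (d : {d : D // R.IsWhiteBlue c d}) :
    R.next⁻¹ ((R.contractYellow c h3 hc).next d).1 = R.flip (R.next d.1) := by
  change R.next⁻¹ (R.next⁻¹ (R.next⁻¹ (R.flip (R.next d.1)))) = _
  rw [h3.next_symm_next_symm, R.next_next_symm]

theorem src_contractYellow_next (h3 : R.IsCubic) {c : R.Face → FaceColor}
    (hc : R.IsProperFaceColoring c) (d : {d : D // R.IsWhiteBlue c d}) :
    R.src ((R.contractYellow c h3 hc).next d).1 = R.tgt (R.next d.1) := by
  rw [← R.src_next_symm, next_symm_contractYellow_next, src_flip]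

/-- Together with its analogue for `flip`, this gives the two-coloring of darts required for
orienting tours. The face to the left of `d` is to the right of the next white-blue dart. -/
theorem left_contractYellow_next_eq_white_iff (h3 : R.IsCubic) {c : R.Face → FaceColor}
    (hc : R.IsProperFaceColoring c) (d : {d : D // R.IsWhiteBlue c d}) :
    c (R.left ((R.contractYellow c h3 hc).next d).1) = .white ↔ c (R.left d.1) ≠ .white := by
  have h1 : R.right ((R.contractYellow c h3 hc).next d).1 = R.left d.1 := by
    rw [← R.left_next_symm, next_symm_contractYellow_next, left_flip, right_next]
  rw [← h1]
  rcases ((R.contractYellow c h3 hc).next d).2 with h | h <;> simp [h]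

theorem left_contractYellow_flip_eq_white_iff (h3 : R.IsCubic) {c : R.Face → FaceColor}
    (hc : R.IsProperFaceColoring c) (d : {d : D // R.IsWhiteBlue c d}) :
    c (R.left ((R.contractYellow c h3 hc).flip d).1) = .white ↔ c (R.left d.1) ≠ .white := by
  change c (R.right d.1) = .white ↔ _
  rcases d.2 with h | h <;> simp [h]

theorem contractYellow_next_ne (h3 : R.IsCubic) {c : R.Face → FaceColor}
    (hc : R.IsProperFaceColoring c) (h : R.NoYellowDigon c)
    (d : {d : D // R.IsWhiteBlue c d}) :
    (R.contractYellow c h3 hc).next d ≠ (R.contractYellow c h3 hc).next⁻¹ d := by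
  intro hd
  have h1 : ((R.contractYellow c h3 hc).next ((R.contractYellow c h3 hc).next d)).1 = d.1 := by
    rw [hd, next_next_symm]
  have key : ∀ d, R.next ((R.contractYellow c h3 hc).next d).1 = R.faceNext (R.next d.1) :=
    fun d => R.next_next_symm _
  refine h (R.next d.1) (d.2.left_next h3 hc) ?_
  rw [← key, ← key, h1]

theorem IsWhiteBlue.eq_of_src_eq (h3 : R.IsCubic) {c : R.Face → FaceColor}
    (hc : R.IsProperFaceColoring c) {d d' : D} (hd : R.IsWhiteBlue c d)
    (hd' : R.IsWhiteBlue c d') (h : R.src d = R.src d') : d = d' := by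
  have h1 := hd'.left_next h3 hc
  rcases (h3.src_eq_iff d d').1 h with rfl | rfl | rfl
  · rfl
  · rcases hd with hd | hd <;> rw [h1] at hd <;> simp at hd
  · rw [← h3.right_next_symm] at h1
    rcases hd with hd | hd <;> rw [h1] at hd <;> simp at hd

theorem dart_cases (h3 : R.IsCubic) {c : R.Face → FaceColor} (hc : R.IsProperFaceColoring c)
    (g : D) : ∃ d : {d : D // R.IsWhiteBlue c d},
      g = d.1 ∨ g = R.next d.1 ∨ g = R.flip (R.next d.1) := by
  obtain ⟨d, hd, hs⟩ := exists_isWhiteBlue h3 hc (R.src g)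
  rcases (h3.src_eq_iff g d).1 hs.symm with rfl | rfl | rfl
  · exact ⟨⟨g, hd⟩, Or.inl rfl⟩
  · exact ⟨⟨d, hd⟩, Or.inr (Or.inl rfl)⟩
  · refine ⟨(R.contractYellow c h3 hc).next⁻¹ ⟨d, hd⟩, Or.inr (Or.inr ?_)⟩
    rw [← next_symm_contractYellow_next h3 hc, next_next_symm]

/-- The two non-white-blue edges at a vertex are consecutive corners of the contraction, so the
alternation conditions agree. Each vertex carries exactly one white-blue dart, so predicates on
vertices and on these darts correspond. -/
theorem isWhiteBlueHamiltonianCycle_iff_isTourCorners [Nonempty D] (h3 : R.IsCubic)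
    (hl : ∀ d, R.src d ≠ R.tgt d) {c : R.Face → FaceColor} (hc : R.IsProperFaceColoring c)
    {C : Set R.Edge} (hC : ∀ d, R.IsWhiteBlue c d → R.edge d ∈ C) :
    R.IsWhiteBlueHamiltonianCycle c C ↔
      (R.contractYellow c h3 hc).IsTourCorners {d | R.edge (R.next d.1) ∈ C} := by
  rw [isWhiteBlueHamiltonianCycle_iff h3 hl hc]
  refine and_congr ?_ ?_
  · have key : ∀ d : {d : D // R.IsWhiteBlue c d},
        R.edge (R.next⁻¹ ((R.contractYellow c h3 hc).next d).1) = R.edge (R.next d.1) :=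
      fun d => by rw [next_symm_contractYellow_next, edge_flip]
    constructor
    · intro h d
      have := (h _ ((R.contractYellow c h3 hc).next d).2).2
      rwa [key] at this
    · intro h d hd
      refine ⟨hC d hd, ?_⟩
      have h1 := h ((R.contractYellow c h3 hc).next⁻¹ ⟨d, hd⟩)
      have h2 := key ((R.contractYellow c h3 hc).next⁻¹ ⟨d, hd⟩)
      rw [next_next_symm] at h1 h2
      rw [h2]
      exact h1
  · constructor
    · intro h P hflip hP x y hx
      have hs : ∀ d : {d : D // R.IsWhiteBlue c d}, ∀ v, R.src d.1 = v →
          ((∃ d' : {d : D // R.IsWhiteBlue c d}, R.src d'.1 = v ∧ P d') ↔ P d) := by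
        rintro d _ rfl
        constructor
        · rintro ⟨d', h1, h2⟩
          rwa [← Subtype.ext (d'.2.eq_of_src_eq h3 hc d.2 h1)]
        · exact fun h => ⟨d, rfl, h⟩
      refine (hs y _ rfl).1 (h (fun v => ∃ d' : {d : D // R.IsWhiteBlue c d},
        R.src d'.1 = v ∧ P d') (fun g hg => ?_) _ _ ((hs x _ rfl).2 hx))
      obtain ⟨d, rfl | rfl | rfl⟩ := dart_cases h3 hc g
      · rw [hs d _ rfl, hs ((R.contractYellow c h3 hc).flip d) (R.tgt d.1) rfl]
        exact hflip d
      · rw [hs d _ (R.src_next _).symm, hs _ _ (src_contractYellow_next h3 hc d)]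
        exact (hP d hg).1
      · rw [edge_flip] at hg
        rw [src_flip, tgt_flip, hs d _ (R.src_next _).symm,
          hs _ _ (src_contractYellow_next h3 hc d)]
        exact (hP d hg).2
    · intro h P hP u v hu
      obtain ⟨x, hx, rfl⟩ := exists_isWhiteBlue h3 hc u
      obtain ⟨y, hy, rfl⟩ := exists_isWhiteBlue h3 hc v
      refine h (fun d => P (R.src d.1)) (fun d => hP d.1 (hC _ d.2)) (fun d hd => ?_)
        ⟨x, hx⟩ ⟨y, hy⟩ hu
      rw [src_contractYellow_next h3 hc d, ← R.src_next d.1]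
      refine ⟨hP _ hd, fun h1 => ?_⟩
      rw [← R.tgt_flip]
      exact hP (R.flip (R.next d.1)) (by rw [edge_flip]; exact hd) h1

/-- A Hamiltonian cycle that uses all white-blue edges corresponds to the set of its edges on
yellow faces. -/
noncomputable def tourCornersEquiv [Nonempty D] (h3 : R.IsCubic)
    (hl : ∀ d, R.src d ≠ R.tgt d) {c : R.Face → FaceColor} (hc : R.IsProperFaceColoring c) :
    {C : Set R.Edge // R.IsWhiteBlueHamiltonianCycle c C} ≃
      {B : Set {d : D // R.IsWhiteBlue c d} // (R.contractYellow c h3 hc).IsTourCorners B} :=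
  Equiv.ofBijective (fun C => ⟨{d | R.edge (R.next d.1) ∈ C.1},
    (isWhiteBlueHamiltonianCycle_iff_isTourCorners h3 hl hc C.2.2).1 C.2⟩) (by
  constructor
  · rintro ⟨C, hC⟩ ⟨C', hC'⟩ h
    have h' : ∀ d : {d : D // R.IsWhiteBlue c d},
        R.edge (R.next d.1) ∈ C ↔ R.edge (R.next d.1) ∈ C' :=
      fun d => Set.ext_iff.1 (congrArg Subtype.val h) d
    refine Subtype.ext (Set.ext fun e => ?_)
    obtain ⟨g, rfl⟩ := R.exists_edge_eq e
    obtain ⟨d, rfl | rfl | rfl⟩ := dart_cases h3 hc g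
    · exact iff_of_true (hC.2 _ d.2) (hC'.2 _ d.2)
    · exact h' d
    · rw [edge_flip]
      exact h' d
  · rintro ⟨B, hB⟩
    let C : Set R.Edge := {e | ∃ d : {d : D // R.IsWhiteBlue c d},
      R.edge d.1 = e ∨ (R.edge (R.next d.1) = e ∧ d ∈ B)}
    have hwb : ∀ d, R.IsWhiteBlue c d → R.edge d ∈ C := fun d hd => ⟨⟨d, hd⟩, Or.inl rfl⟩
    have hCB : {d : {d : D // R.IsWhiteBlue c d} | R.edge (R.next d.1) ∈ C} = B := by
      ext d
      have hy := d.2.left_next h3 hc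
      constructor
      · rintro ⟨d', h | ⟨h, hd'⟩⟩
        · have h1 : R.IsWhiteBlue c (R.next d.1) := by
            rcases (R.edge_eq_iff _ _).1 h with h | h
            · rw [← h]; exact d'.2
            · rw [← R.isWhiteBlue_flip, ← h]; exact d'.2
          rcases h1 with h1 | h1 <;> rw [hy] at h1 <;> simp at h1
        · rcases (R.edge_eq_iff _ _).1 h with h | h
          · rwa [← Subtype.ext (R.next.injective h)]
          -- The reverse of `next d` has yellow on its right, whereas `next d'` has a side of the
          -- white-blue edge there. So no edge arises from two corners.
          · have h1 : c (R.left d'.1) = .yellow := by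
              rw [← R.right_next, h, right_flip, hy]
            rcases d'.2 with h2 | h2 <;> rw [h1] at h2 <;> simp at h2
      · exact fun hd => ⟨d, Or.inr ⟨rfl, hd⟩⟩
    exact ⟨⟨C, (isWhiteBlueHamiltonianCycle_iff_isTourCorners h3 hl hc hwb).2 (hCB ▸ hB)⟩,
      Subtype.ext hCB⟩)

theorem nonempty_whiteBlue [Nonempty D] (h3 : R.IsCubic) {c : R.Face → FaceColor}
    (hc : R.IsProperFaceColoring c) : Nonempty {d : D // R.IsWhiteBlue c d} :=
  let ⟨d, hd, _⟩ := exists_isWhiteBlue h3 hc (R.src (Classical.arbitrary D))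
  ⟨⟨d, hd⟩⟩

/-- The Hamiltonian cycle that separates the white from the blue faces of a recoloring. -/
noncomputable def recoloringEquiv [Finite D] (hp : R.IsConnectedPlane) (h3 : R.IsCubic)
    (hl : ∀ d, R.src d ≠ R.tgt d) {c : R.Face → FaceColor} (hc : R.IsProperFaceColoring c)
    {outer : R.Face} (hout : c outer = .white) :
    {a : R.Face → FaceColor // R.IsConnectedRecoloring c a} ≃
      {C : Set R.Edge // R.IsSeparatingHamiltonianCycle outer c C} :=
  have := hp.nonempty
  Equiv.ofBijective (fun a => ⟨R.boundary a.1, by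
    have hb := (a.2.isRecoloring.isBoundary_iff _).2 rfl
    rw [isSeparatingHamiltonianCycle_iff hp h3 hl hc hout, isWhiteBlueHamiltonianCycle_iff h3 hl hc]
    exact ⟨a.2.isRecoloring.isAlternating h3 hc hb, a.2.connectedBy hp h3 hc hb⟩⟩) (by
  constructor
  · rintro ⟨a, ha⟩ ⟨b, hb⟩ hab
    have hab' : R.boundary a = R.boundary b := congrArg Subtype.val hab
    -- The cycle determines the coloring, since the white faces are those not inside it.
    have h1 := ha.isInside_iff ((ha.isRecoloring.isBoundary_iff _).2 rfl) hout
    have h2 := hb.isInside_iff ((hb.isRecoloring.isBoundary_iff _).2 rfl) hout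
    rw [hab'] at h1
    refine Subtype.ext (funext fun f => ?_)
    have h4 := (h1 f).symm.trans (h2 f)
    show a f = b f
    rcases ha.isRecoloring.white_or_blue f with h | h <;>
      rcases hb.isRecoloring.white_or_blue f with h' | h' <;> simp [h, h'] at h4 ⊢
  · rintro ⟨C, hC⟩
    have h1 := hC
    rw [isSeparatingHamiltonianCycle_iff hp h3 hl hc hout,
      isWhiteBlueHamiltonianCycle_iff h3 hl hc] at h1
    obtain ⟨a, ha, h2⟩ := h1.1.exists_isConnectedRecoloring hp h3 hc h1.2 hout
    exact ⟨⟨a, ha⟩, Subtype.ext ((ha.isRecoloring.isBoundary_iff C).1 h2).symm⟩)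

end RotationSystem

/-! ### Assembly of the bijections -/

theorem mainTheorem11 {D : Type*} [Finite D] (G : RotationSystem D)
    (hplane : G.IsConnectedPlane) (h3 : G.IsCubic) (hbip : MultiGraph.Bipartite G.graph)
    (outer : G.Face) (c : G.Face → FaceColor) (hc : G.IsProperFaceColoring c)
    (hout : c outer = FaceColor.white) :
    ∃ (e₁₂ : {a : G.Face → FaceColor // G.IsConnectedRecoloring c a} ≃
          {C : Set G.Edge // G.IsSeparatingHamiltonianCycle outer c C})
      (e₂₃ : {C : Set G.Edge // G.IsSeparatingHamiltonianCycle outer c C} ≃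
          {C : Set G.Edge // G.IsWhiteBlueHamiltonianCycle c C})
      (e₃₄ : {C : Set G.Edge // G.IsWhiteBlueHamiltonianCycle c C} ≃
          {A : Set D // G.IsDirectedHamiltonianCycle (G.orientation c) A})
      (e₃₅ : {C : Set G.Edge // G.IsWhiteBlueHamiltonianCycle c C} ≃
          (G.contractYellow c h3 hc).SidedKikiEulerTour)
      (e₂₆ : {C : Set G.Edge // G.IsSeparatingHamiltonianCycle outer c C} ≃
          {S : Set G.Face //
            MultiGraph.IsTRVB (G.nonwhiteDual c) {f | c f = FaceColor.yellow} S}),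
      (∀ a d, G.edge d ∈ (e₁₂ a).1 ↔ a.1 (G.left d) ≠ a.1 (G.right d)) ∧
      (∀ C, (e₂₃ C).1 = C.1) ∧
      (∀ C, G.edge '' (e₃₄ C).1 = C.1) ∧
      (∀ C t, e₃₅ C = Quot.mk _ t → ∀ d : {d : D // G.IsWhiteBlue c d},
        G.edge (G.next d.1) ∈ C.1 ↔
          (d, true) ∈ t.1 ∨ ((G.contractYellow c h3 hc).next d, false) ∈ t.1) ∧
      (∀ C f, f ∈ (e₂₆ C).1 ↔ c f = FaceColor.yellow ∧ ¬ G.IsInside outer C.1 f) ∧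
      (G.NoYellowDigon c →
        ∃ e : {C : Set G.Edge // G.IsWhiteBlueHamiltonianCycle c C} ≃
            (G.contractYellow c h3 hc).KikiEulerTour,
          ∀ C t, e C = Quot.mk _ t → ∀ d d' : {d : D // G.IsWhiteBlue c d},
            d' = (G.contractYellow c h3 hc).next d →
            (G.edge (G.next d.1) ∈ C.1 ↔
              RotationSystem.FollowedBy t.1 ((G.contractYellow c h3 hc).flip d) d' ∨
              RotationSystem.FollowedBy t.1 ((G.contractYellow c h3 hc).flip d') d)) := by
  have hl := RotationSystem.src_ne_tgt_of_bipartite hbip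
  have := hplane.nonempty
  have := RotationSystem.nonempty_whiteBlue h3 hc
  let e₁₂ := RotationSystem.recoloringEquiv hplane h3 hl hc hout
  let eC := RotationSystem.tourCornersEquiv h3 hl hc
  let eS := RotationSystem.sidedKikiEulerTourEquiv (G.contractYellow c h3 hc)
    (fun d => c (G.left d.1) = .white)
    (RotationSystem.left_contractYellow_flip_eq_white_iff h3 hc)
    (RotationSystem.left_contractYellow_next_eq_white_iff h3 hc)
  refine ⟨e₁₂, Equiv.subtypeEquivRight
    (RotationSystem.isSeparatingHamiltonianCycle_iff hplane h3 hl hc hout),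
    RotationSystem.directedEquiv h3 hl hc, eC.trans eS.symm,
    e₁₂.symm.trans (RotationSystem.trvbEquiv hplane h3 hc),
    fun a => RotationSystem.edge_mem_boundary a.1, fun _ => rfl,
    RotationSystem.edge_image_directedEquiv h3 hl hc, fun C t h d => ?_, fun C f => ?_,
    fun hd => ?_⟩
  · have h1 : eC C = eS (Quot.mk _ t) := by rw [← h]; simp
    exact Set.ext_iff.1 (congrArg Subtype.val h1) d
  · obtain ⟨a, rfl⟩ := e₁₂.surjective C
    rw [Equiv.trans_apply, Equiv.symm_apply_apply, RotationSystem.mem_trvbEquiv,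
      a.2.isInside_iff (C := (e₁₂ a).1) ((a.2.isRecoloring.isBoundary_iff _).2 rfl) hout, not_not]
  · let eK := RotationSystem.kikiEulerTourEquiv (G.contractYellow c h3 hc)
      (fun d => c (G.left d.1) = .white)
      (RotationSystem.left_contractYellow_flip_eq_white_iff h3 hc)
      (RotationSystem.left_contractYellow_next_eq_white_iff h3 hc)
      (RotationSystem.contractYellow_next_ne h3 hc hd)
    refine ⟨eC.trans eK.symm, ?_⟩
    rintro C t h d _ rfl
    have h1 : eC C = eK (Quot.mk _ t) := by rw [← h]; simp
    exact Set.ext_iff.1 (congrArg Subtype.val h1) d
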